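/- Let $\mathcal P(\mathbb R)$ be the set of Borel probability measures on $\mathbb R$ with finite first moment. For finite Borel measures $\mu,\nu$ on $\mathbb R$ with finite first moment, write $\mu\le_{\rm cx}\nu$ if $\int\phi\,\mathrm d\mu\le\int\phi\,\mathrm d\nu$ (in $(-\infty,\infty]$) for every convex $\phi:\mathbb R\to\mathbb R$. The shadow of $\mu$ in $\nu$ is $S^\nu(\mu)=\min\{\eta:\ \mu\le_{\rm cx}\eta\le\nu\}$, where $\eta\le\nu$ is meant setwise and the minimum is taken in the partial order $\le_{\rm cx}$. For $\mu,\nu\in\mathcal P(\mathbb R)$, a martingale transport (MT) from $\mu$ to $\nu$ is the law $\pi$ on $\mathbb R\times\mathbb R$ of a pair $(X,Y)$ with $X\sim\mu$, $Y\sim\nu$ and $\mathbb E[Y\mid X]=X$; it is a (backward) Monge martingale transport (MMT) if in addition $\pi$ is the law of $(f(Y),Y)$ for some Borel function $f:\mathbb R\to\mathbb R$. **Proposition.** Let $\mu,\nu\in\mathcal P(\mathbb R)$ with $\mu\le_{\rm cx}\nu$ (atoms are allowed). Then the following are equivalent: 1. there is exactly one martingale transport from $\mu$ to $\nu$, and it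 is a Monge martingale transport; 2. for every $n\in\mathbb N$ and all pairwise mutually singular measures $\mu_1,\dots,\mu_n\le\mu$, the shadows $S^\nu(\mu_1),\dots,S^\nu(\mu_n)$ are pairwise mutually singular. -/

import Mathlib

open MeasureTheory

/-- `FiniteFirstMoment μ`: the function `x ↦ x` is `μ`-integrable. -/
def FiniteFirstMoment (μ : Measure ℝ) : Prop :=
  Integrable (fun x : ℝ => x) μ

/-- The convex order `μ ≤_cx ν` for finite measures on `ℝ` with finite first moment:
`∫ φ ∂μ ≤ ∫ φ ∂ν` for every convex `φ : ℝ → ℝ`. A convex function has an affine minorant, so both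
integrals are well defined in `(-∞, +∞]`. If `φ` is not `ν`-integrable, the right-hand side is `+∞`
and there is nothing to check; otherwise the inequality says that the left-hand side is finite
and at most the right-hand side. -/
def ConvexOrder (μ ν : Measure ℝ) : Prop :=
  ∀ φ : ℝ → ℝ, ConvexOn ℝ Set.univ φ → Integrable φ ν →
    Integrable φ μ ∧ ∫ x, φ x ∂μ ≤ ∫ x, φ x ∂ν

/-- `IsShadow ν μ η`: `η` is the minimum, in the convex order, of
the set of measures `η'` with `μ ≤_cx η' ≤ ν`. -/
structure IsShadow (ν μ η : Measure ℝ) : Prop where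
  convexOrder : ConvexOrder μ η
  le : η ≤ ν
  min : ∀ η' : Measure ℝ, ConvexOrder μ η' → η' ≤ ν → ConvexOrder η η'

open Classical in
/-- The shadow `S^ν(μ)` of `μ` in `ν`, that is `min {η : μ ≤_cx η ≤ ν}` with respect to the convex
order. (The minimum exists, and is unique, whenever `μ`, `ν` are finite measures with finite
first moment with `∫ φ ∂μ ≤ ∫ φ ∂ν` for all nonnegative convex `φ`; outside of this case the value
is irrelevant.) -/
noncomputable def shadow (ν μ : Measure ℝ) : Measure ℝ :=
  if h : ∃ η, IsShadow ν μ η then h.choose else 0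

/-- The set of martingale transports from `μ` to `ν`: the laws `π` on `ℝ × ℝ` of pairs `(X, Y)` with
`X ∼ μ`, `Y ∼ ν` and `E[Y | X] = X`. -/
def martingaleTransports (μ ν : Measure ℝ) : Set (Measure (ℝ × ℝ)) :=
  {π | π.map Prod.fst = μ ∧ π.map Prod.snd = ν ∧
    π[(Prod.snd : ℝ × ℝ → ℝ) | MeasurableSpace.comap (Prod.fst : ℝ × ℝ → ℝ) inferInstance]
      =ᵐ[π] Prod.fst}

/-- The set of (backward) Monge martingale transports from `μ` to `ν`: the martingale transports
that are the law of `(f(Y), Y)` with `Y ∼ ν`, for some Borel function `f`. -/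
def mongeMartingaleTransports (μ ν : Measure ℝ) : Set (Measure (ℝ × ℝ)) :=
  {π | π ∈ martingaleTransports μ ν ∧
    ∃ f : ℝ → ℝ, Measurable f ∧ π = ν.map (fun y => (f y, y))}

/-!
Write `μ_A` for the restriction of `μ` to `A`.

Suppose that mutually singular parts of `μ` have mutually singular shadows. For a Borel set `A`,
the shadows of `μ_A` and `μ_{Aᶜ}` lie below `ν` and are mutually singular, so their sum lies below
`ν`, and by comparison of masses it equals `ν`. A martingale coupling `π` sends `μ_A` and `μ_{Aᶜ}`
to measures below `ν` that dominate the two shadows in the convex order and also add up to `ν`;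
hence `π` sends `μ_A` exactly to its shadow (`IsMartingaleCoupling.imageOn_eq_shadow`). This
determines `π`, and as the images of `{X ≤ q}` and `{X > q}` are mutually singular, `Y` determines
whether `X ≤ q` for each rational `q`, so that `X` is a function of `Y`
(`exists_measurable_eq_map_of_mutuallySingular_imageOn`).

Conversely, let the unique martingale coupling be the law of `(f(Y), Y)`. If `μ₁ ≤ μ`, then
`μ - μ₁` is dominated in the convex order by what the shadow of `μ₁` leaves of `ν`, so there is a
martingale coupling which sends `μ₁` to its shadow; by uniqueness it is the law of `(f(Y), Y)`,
and the shadow of `μ₁` lives on `f ⁻¹' s` whenever `μ₁` lives on `s` (`shadow_preimage_eq_zero`).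
So `f` separates the shadows of mutually singular measures.

Two facts are used throughout.

* The shadow of `μ₁` exists, and the remaining part of `ν` dominates `μ - μ₁`
  (`exists_isShadow_add`). In terms of call functions `x ↦ ∫ (s - x)⁺ dμ(s)`, the remainder is the
  greatest convex minorant of `call ν - call μ₁`. That the shadow is a measure means that `call ν`
  minus this minorant is convex (`ConvexOn.exists_greatest_minorant_sub`). The dictionary between
  measures in convex order and call functions comes from the Taylor formula of a convex function
  with a second derivative measure (`ConvexOn.exists_lintegral_kernel`).
* Strassen's theorem: measures in convex order have a martingale coupling
  (`ConvexOrder.exists_isMartingaleCoupling`). It is obtained from the extension theorem for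
  positive functionals, whose hypothesis is the dual inequality `ConvexOrder.integral_add_nonneg`.
-/

open Set Filter Topology

/-! ### Integral representation of convex functions -/

theorem ConvexOn.continuous_of_univ {φ : ℝ → ℝ} (hφ : ConvexOn ℝ univ φ) : Continuous φ := by
  have := hφ.continuousOn_interior
  rwa [interior_univ, continuousOn_univ] at this

open intervalIntegral in
/-- A convex function is the primitive of a right-continuous increasing function, the right limit
of its right derivative. Both have the same integrals because a monotone function has only
countably many discontinuities. -/
theorem ConvexOn.exists_stieltjesFunction {φ : ℝ → ℝ} (hφ : ConvexOn ℝ univ φ) :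
    ∃ G : StieltjesFunction ℝ, ∀ a b, ∫ t in a..b, G t = φ b - φ a := by
  have hmono : Monotone fun x => derivWithin φ (Ioi x) x := by
    have := hφ.monotoneOn_rightDeriv
    rw [interior_univ] at this
    exact monotoneOn_univ.mp this
  have hle : ∀ a b, a ≤ b → ∫ t in a..b, hmono.stieltjesFunction t = φ b - φ a := by
    intro a b hab
    rw [← integral_eq_sub_of_hasDeriv_right_of_le hab hφ.continuous_of_univ.continuousOn
      (fun x _ => hφ.hasDerivWithinAt_rightDeriv_of_mem_interior (by simp))
      hmono.intervalIntegrable]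
    refine integral_congr_ae ?_
    have : ∀ᵐ x : ℝ, ContinuousAt (fun x => derivWithin φ (Ioi x) x) x :=
      hmono.countable_not_continuousAt.ae_notMem volume |>.mono fun x hx => by simpa using hx
    filter_upwards [this] with x hx _
    rw [hmono.stieltjesFunction_eq]
    exact ContinuousWithinAt.rightLim_eq (ContinuousAt.continuousWithinAt hx)
  refine ⟨hmono.stieltjesFunction, fun a b => ?_⟩
  rcases le_total a b with h | h
  · exact hle a b h
  · rw [integral_symm, hle b a h]; ring

theorem StieltjesFunction.mul_sub_le_integral (G : StieltjesFunction ℝ) (a x : ℝ) :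
    G a * (x - a) ≤ ∫ t in a..x, G t := by
  rcases le_total a x with h | h
  · have := intervalIntegral.integral_mono_on (μ := volume) h (f := fun _ => G a) (g := G)
      (by simp) G.mono.intervalIntegrable (fun t ht => G.mono ht.1)
    simp only [intervalIntegral.integral_const, smul_eq_mul] at this
    linarith
  · have := intervalIntegral.integral_mono_on (μ := volume) h (g := fun _ => G a) (f := G)
      G.mono.intervalIntegrable (by simp) (fun t ht => G.mono ht.2)
    simp only [intervalIntegral.integral_const, smul_eq_mul] at this
    rw [intervalIntegral.integral_symm]
    linarith

/-- Tonelli: the primitive of `G` minus its tangent at `a` is a mixture of the hinge functions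
`x ↦ (x - s)⁺` for `a < s` and `x ↦ (s - x)⁺` for `s ≤ a`, weighted by the Stieltjes measure of `G`.
The truncation at `0` is the one of `ENNReal.ofReal`. -/
theorem StieltjesFunction.lintegral_kernel (G : StieltjesFunction ℝ) (a x : ℝ) :
    ∫⁻ s, ENNReal.ofReal (if a < s then x - s else s - x) ∂G.measure =
      ENNReal.ofReal ((∫ t in a..x, G t) - G a * (x - a)) := by
  symm
  have hm := G.mono.measurable
  rcases le_total a x with h | h
  · have e1 : (∫ t in a..x, G t) - G a * (x - a) = ∫ t in Ioc a x, (G t - G a) := by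
      rw [← intervalIntegral.integral_of_le h, intervalIntegral.integral_sub
        G.mono.intervalIntegrable (by simp)]
      simp [mul_comm]
    rw [e1, ofReal_integral_eq_lintegral_ofReal]
    · calc ∫⁻ t in Ioc a x, ENNReal.ofReal (G t - G a)
          = ∫⁻ t in Ioc a x, ∫⁻ s, (Ioc a t).indicator 1 s ∂G.measure := by
            refine lintegral_congr fun t => ?_
            rw [lintegral_indicator_one measurableSet_Ioc, G.measure_Ioc]
        _ = ∫⁻ s, (∫⁻ t in Ioc a x, (Ioc a t).indicator 1 s) ∂G.measure := by
            refine lintegral_lintegral_swap (Measurable.aemeasurable ?_)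
            have : Function.uncurry (fun (t s : ℝ) => (Ioc a t).indicator (1 : ℝ → ENNReal) s) =
                {p : ℝ × ℝ | a < p.2 ∧ p.2 ≤ p.1}.indicator 1 := by
              ext p; simp [Function.uncurry, indicator]
            rw [this]
            exact measurable_one.indicator ((measurableSet_lt measurable_const measurable_snd).inter
              (measurableSet_le measurable_snd measurable_fst))
        _ = _ := by
            refine lintegral_congr fun s => ?_
            by_cases has : a < s
            · have : (fun t => (Ioc a t).indicator (1 : ℝ → ENNReal) s) = (Ici s).indicator 1 := by
                ext t; simp [indicator, has]
              rw [this, lintegral_indicator_one measurableSet_Ici,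
                Measure.restrict_apply measurableSet_Ici, if_pos has, ← Real.volume_Icc]
              congr 1
              ext t; simp only [mem_inter_iff, mem_Ici, mem_Ioc, mem_Icc]
              constructor
              · rintro ⟨h1, h2, h3⟩; exact ⟨h1, h3⟩
              · rintro ⟨h1, h2⟩; exact ⟨h1, has.trans_le h1, h2⟩
            · simp only [indicator, mem_Ioc, has, false_and, if_false, lintegral_zero]
              rw [ENNReal.ofReal_of_nonpos (by linarith)]
    · exact (G.mono.intervalIntegrable.1.sub (by simp))
    · refine (ae_restrict_mem measurableSet_Ioc).mono fun t ht => ?_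
      exact sub_nonneg.2 (G.mono ht.1.le)
  · have e1 : (∫ t in a..x, G t) - G a * (x - a) = ∫ t in Ioc x a, (G a - G t) := by
      rw [← intervalIntegral.integral_of_le h, intervalIntegral.integral_sub
        (by simp) G.mono.intervalIntegrable, intervalIntegral.integral_symm]
      simp; ring
    rw [e1, ofReal_integral_eq_lintegral_ofReal]
    · calc ∫⁻ t in Ioc x a, ENNReal.ofReal (G a - G t)
          = ∫⁻ t in Ioc x a, ∫⁻ s, (Ioc t a).indicator 1 s ∂G.measure := by
            refine lintegral_congr fun t => ?_
            rw [lintegral_indicator_one measurableSet_Ioc, G.measure_Ioc]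
        _ = ∫⁻ s, (∫⁻ t in Ioc x a, (Ioc t a).indicator 1 s) ∂G.measure := by
            refine lintegral_lintegral_swap (Measurable.aemeasurable ?_)
            have : Function.uncurry (fun (t s : ℝ) => (Ioc t a).indicator (1 : ℝ → ENNReal) s) =
                {p : ℝ × ℝ | p.1 < p.2 ∧ p.2 ≤ a}.indicator 1 := by
              ext p; simp [Function.uncurry, indicator]
            rw [this]
            exact measurable_one.indicator ((measurableSet_lt measurable_fst measurable_snd).inter
              (measurableSet_le measurable_snd measurable_const))
        _ = _ := by
            refine lintegral_congr fun s => ?_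
            by_cases has : a < s
            · have has' : ¬ s ≤ a := not_le.2 has
              simp only [indicator, mem_Ioc, has', and_false, if_false, lintegral_zero, has,
                if_true]
              rw [ENNReal.ofReal_of_nonpos (by linarith)]
            · have has' : s ≤ a := not_lt.1 has
              have : (fun t => (Ioc t a).indicator (1 : ℝ → ENNReal) s) = (Iio s).indicator 1 := by
                ext t; simp [indicator, has']
              rw [this, lintegral_indicator_one measurableSet_Iio,
                Measure.restrict_apply measurableSet_Iio, if_neg has, ← Real.volume_Ioo]
              congr 1
              ext t; simp only [mem_inter_iff, mem_Iio, mem_Ioc, mem_Ioo]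
              constructor
              · rintro ⟨h1, h2, h3⟩; exact ⟨h2, h1⟩
              · rintro ⟨h1, h2⟩; exact ⟨h2, h1, h2.le.trans has'⟩
    · exact (Integrable.sub (by simp) G.mono.intervalIntegrable.1)
    · refine (ae_restrict_mem measurableSet_Ioc).mono fun t ht => ?_
      exact sub_nonneg.2 (G.mono ht.2)

/-- Taylor formula of a convex function with the second derivative read as a measure: around
every base point `a`, it is the sum of a supporting line and of a mixture of hinge functions. -/
theorem ConvexOn.exists_lintegral_kernel {φ : ℝ → ℝ} (hφ : ConvexOn ℝ univ φ) :
    ∃ G : StieltjesFunction ℝ, ∀ a x, φ a + G a * (x - a) ≤ φ x ∧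
      ∫⁻ s, ENNReal.ofReal (if a < s then x - s else s - x) ∂G.measure =
        ENNReal.ofReal (φ x - φ a - G a * (x - a)) := by
  obtain ⟨G, hG⟩ := hφ.exists_stieltjesFunction
  refine ⟨G, fun a x => ⟨?_, ?_⟩⟩
  · have := G.mul_sub_le_integral a x
    rw [hG] at this
    linarith
  · rw [G.lintegral_kernel, hG]

/-! ### Call functions -/

/-- The call function `x ↦ ∫ (s - x)⁺ dμ(s)` of `μ`. -/
noncomputable def call (μ : Measure ℝ) (x : ℝ) : ℝ := ∫ s, max (s - x) 0 ∂μ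

theorem FiniteFirstMoment.mono {μ ν : Measure ℝ} (hν : FiniteFirstMoment ν) (h : μ ≤ ν) :
    FiniteFirstMoment μ := Integrable.mono_measure hν h

theorem FiniteFirstMoment.integrable_call {μ : Measure ℝ} [IsFiniteMeasure μ]
    (hμ : FiniteFirstMoment μ) (x : ℝ) : Integrable (fun s => max (s - x) 0) μ :=
  (Integrable.sub hμ (integrable_const x)).pos_part

theorem call_nonneg (μ : Measure ℝ) (x : ℝ) : 0 ≤ call μ x :=
  integral_nonneg fun _ => le_max_right _ _

theorem ofReal_call {μ : Measure ℝ} [IsFiniteMeasure μ] (hμ : FiniteFirstMoment μ) (x : ℝ) :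
    ∫⁻ s, ENNReal.ofReal (s - x) ∂μ = ENNReal.ofReal (call μ x) := by
  rw [call, ofReal_integral_eq_lintegral_ofReal (hμ.integrable_call x)
    (ae_of_all _ fun _ => le_max_right _ _)]
  refine lintegral_congr fun s => ?_
  simp [ENNReal.ofReal_max]

theorem call_add_measure {μ ν : Measure ℝ} [IsFiniteMeasure μ] [IsFiniteMeasure ν]
    (hμ : FiniteFirstMoment μ) (hν : FiniteFirstMoment ν) (x : ℝ) :
    call (μ + ν) x = call μ x + call ν x :=
  integral_add_measure (hμ.integrable_call x) (hν.integrable_call x)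

theorem convexOn_max_sub (s : ℝ) : ConvexOn ℝ univ fun x : ℝ => max (s - x) 0 :=
  ((convexOn_const s convex_univ).sub (concaveOn_id convex_univ)).sup
    (convexOn_const 0 convex_univ)

theorem convexOn_sub_max (x : ℝ) : ConvexOn ℝ univ fun s : ℝ => max (s - x) 0 :=
  ((convexOn_id convex_univ).sub (concaveOn_const x convex_univ)).sup
    (convexOn_const 0 convex_univ)

theorem convexOn_call {μ : Measure ℝ} [IsFiniteMeasure μ] (hμ : FiniteFirstMoment μ) :
    ConvexOn ℝ univ (call μ) := by
  refine ⟨convex_univ, fun x _ y _ a b ha hb hab => ?_⟩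
  simp only [call, smul_eq_mul]
  rw [← integral_const_mul, ← integral_const_mul, ← integral_add
    ((hμ.integrable_call x).const_mul a) ((hμ.integrable_call y).const_mul b)]
  exact integral_mono (hμ.integrable_call _)
    (((hμ.integrable_call x).const_mul a).add ((hμ.integrable_call y).const_mul b))
    fun s => (convexOn_max_sub s).2 (mem_univ x) (mem_univ y) ha hb hab

theorem tendsto_call_atTop {μ : Measure ℝ} [IsFiniteMeasure μ] (hμ : FiniteFirstMoment μ) :
    Tendsto (call μ) atTop (𝓝 0) := by
  have : Tendsto (call μ) atTop (𝓝 (∫ _, (0 : ℝ) ∂μ)) := by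
    refine tendsto_integral_filter_of_dominated_convergence (fun s => |s|)
      (Eventually.of_forall fun x => (hμ.integrable_call x).1) ?_ hμ.abs ?_
    · filter_upwards [eventually_ge_atTop 0] with x hx
      refine ae_of_all _ fun s => ?_
      rw [Real.norm_eq_abs, abs_of_nonneg (le_max_right _ _)]
      exact max_le (by linarith [le_abs_self s]) (abs_nonneg s)
    · refine ae_of_all _ fun s => ?_
      refine tendsto_const_nhds.congr' ?_
      filter_upwards [eventually_ge_atTop s] with x hx
      rw [max_eq_right (by linarith)]
  simpa using this

theorem tendsto_call_div_atBot {μ : Measure ℝ} [IsFiniteMeasure μ] (hμ : FiniteFirstMoment μ) :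
    Tendsto (fun x => call μ x / -x) atBot (𝓝 (μ.real univ)) := by
  have : Tendsto (fun x => ∫ s, max (s - x) 0 / -x ∂μ) atBot (𝓝 (∫ _, (1 : ℝ) ∂μ)) := by
    refine tendsto_integral_filter_of_dominated_convergence (fun s => |s| + 1)
      (Eventually.of_forall fun x => ((hμ.integrable_call x).div_const _).1) ?_
      (hμ.abs.add (integrable_const 1)) ?_
    · filter_upwards [eventually_le_atBot (-1)] with x hx
      refine ae_of_all _ fun s => ?_
      have hx' : 0 < -x := by linarith
      rw [Real.norm_eq_abs, abs_of_nonneg (div_nonneg (le_max_right _ _) hx'.le),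
        div_le_iff₀ hx']
      refine max_le ?_ (by positivity)
      nlinarith [le_abs_self s, abs_nonneg s]
    · refine ae_of_all _ fun s => ?_
      have h1 : Tendsto (fun x : ℝ => s / -x + 1) atBot (𝓝 (0 + 1)) :=
        (tendsto_const_nhds.div_atTop tendsto_neg_atBot_atTop).add tendsto_const_nhds
      rw [zero_add] at h1
      refine h1.congr' ?_
      filter_upwards [eventually_le_atBot s, eventually_lt_atBot 0] with x hx hx0
      have hx1 : x ≠ 0 := hx0.ne
      rw [max_eq_left (by linarith)]
      field_simp
      ring
  simp only [integral_div] at this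
  simpa [call] using this

theorem tendsto_call_add_atBot {μ : Measure ℝ} [IsFiniteMeasure μ] (hμ : FiniteFirstMoment μ) :
    Tendsto (fun x => call μ x + μ.real univ * x) atBot (𝓝 (∫ s, s ∂μ)) := by
  have : Tendsto (fun x => ∫ s, (max (s - x) 0 + x) ∂μ) atBot (𝓝 (∫ s, s ∂μ)) := by
    refine tendsto_integral_filter_of_dominated_convergence (fun s => |s|)
      (Eventually.of_forall fun x => ((hμ.integrable_call x).add (integrable_const x)).1) ?_
      hμ.abs ?_
    · filter_upwards [eventually_le_atBot 0] with x hx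
      refine ae_of_all _ fun s => ?_
      rw [Real.norm_eq_abs, abs_le]
      rcases max_cases (s - x) 0 with h | h <;> constructor <;>
        linarith [le_abs_self s, neg_abs_le s]
    · refine ae_of_all _ fun s => ?_
      refine tendsto_const_nhds.congr' ?_
      filter_upwards [eventually_le_atBot s] with x hx
      rw [max_eq_left (by linarith)]; ring
  refine this.congr fun x => ?_
  rw [integral_add (hμ.integrable_call x) (integrable_const x)]
  simp [call]

/-- A measure is determined by its call function if the latter is finite. Neither measure is
assumed finite, so that this applies to measures known only through their call function. The mass
of `(k, ∞)` is the limit of the difference quotients of the call function at `k`. -/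
theorem ext_of_lintegral_call {μ ν : Measure ℝ}
    (h : ∀ x, ∫⁻ s, ENNReal.ofReal (s - x) ∂μ = ∫⁻ s, ENNReal.ofReal (s - x) ∂ν)
    (hfin : ∀ x, ∫⁻ s, ENNReal.ofReal (s - x) ∂ν ≠ ⊤) : μ = ν := by
  have hIoi : ∀ k, μ (Ioi k) = ν (Ioi k) := by
    intro k
    let F : ℕ → ℝ → ENNReal := fun n s => ENNReal.ofReal (min ((n + 1 : ℝ) * (s - k)) 1)
    have hFm : ∀ n, Measurable (F n) := fun n => by fun_prop
    have key : ∀ (ρ : Measure ℝ) (n : ℕ), ENNReal.ofReal (n + 1) * ∫⁻ s, ENNReal.ofReal (s - k) ∂ρ =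
        ∫⁻ s, F n s ∂ρ +
          ENNReal.ofReal (n + 1) * ∫⁻ s, ENNReal.ofReal (s - (k + 1 / (n + 1))) ∂ρ := by
      intro ρ n
      have hn : (0 : ℝ) < n + 1 := by positivity
      rw [← lintegral_const_mul _ (by fun_prop), ← lintegral_const_mul _ (by fun_prop),
        ← lintegral_add_left (hFm n)]
      refine lintegral_congr fun s => ?_
      rw [← ENNReal.ofReal_mul hn.le, ← ENNReal.ofReal_mul hn.le]
      have e : (n + 1 : ℝ) * (s - (k + 1 / (n + 1))) = (n + 1 : ℝ) * (s - k) - 1 := by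
        field_simp; ring
      rw [e]
      simp only [F]
      rcases le_total ((n + 1 : ℝ) * (s - k)) 1 with h1 | h1
      · rw [min_eq_left h1, ENNReal.ofReal_of_nonpos (by linarith : (n + 1 : ℝ) * (s - k) - 1 ≤ 0),
          add_zero]
      · rw [min_eq_right h1, ← ENNReal.ofReal_add zero_le_one (by linarith)]
        congr 1; ring
    have hF : ∀ n, ∫⁻ s, F n s ∂μ = ∫⁻ s, F n s ∂ν := by
      intro n
      have h1 := key μ n
      rw [h, h, key ν n] at h1
      exact ((ENNReal.add_left_inj (ENNReal.mul_ne_top ENNReal.ofReal_ne_top (hfin _))).1 h1).symm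
    have lim : ∀ ρ : Measure ℝ, Tendsto (fun n => ∫⁻ s, F n s ∂ρ) atTop (𝓝 (ρ (Ioi k))) := by
      intro ρ
      rw [← lintegral_indicator_one measurableSet_Ioi]
      refine lintegral_tendsto_of_tendsto_of_monotone (fun n => (hFm n).aemeasurable)
        (ae_of_all _ fun s n m hnm => ?_) (ae_of_all _ fun s => ?_)
      · rcases le_total s k with hs | hs
        · simp only [F]
          rw [ENNReal.ofReal_of_nonpos]
          · exact zero_le
          · exact (min_le_left _ _).trans (mul_nonpos_of_nonneg_of_nonpos (by positivity)
              (by linarith))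
        · have : (n : ℝ) ≤ m := by exact_mod_cast hnm
          have : 0 ≤ s - k := by linarith
          simp only [F]
          gcongr
      · by_cases hs : k < s
        · have : ∀ᶠ n : ℕ in atTop, 1 / (s - k) ≤ n :=
            (tendsto_natCast_atTop_atTop).eventually_ge_atTop _
          refine tendsto_const_nhds.congr' ?_
          filter_upwards [this] with n hn
          have hsk : 0 < s - k := by linarith
          rw [div_le_iff₀ hsk] at hn
          simp only [F, indicator, mem_Ioi, hs, if_true, Pi.one_apply]
          rw [min_eq_right (by nlinarith), ENNReal.ofReal_one]
        · refine tendsto_const_nhds.congr fun n => ?_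
          simp only [F, indicator, mem_Ioi, hs, if_false]
          rw [ENNReal.ofReal_of_nonpos]
          exact (min_le_left _ _).trans (mul_nonpos_of_nonneg_of_nonpos (by positivity)
              (by linarith))
    exact tendsto_nhds_unique (lim μ) (by simpa only [hF] using lim ν)
  have hIoi_top : ∀ k, μ (Ioi k) ≠ ⊤ := by
    intro k
    rw [hIoi]
    refine ne_top_of_le_ne_top (hfin (k - 1)) ?_
    rw [← lintegral_indicator_one measurableSet_Ioi]
    refine lintegral_mono fun s => ?_
    by_cases hs : k < s
    · simp only [indicator, mem_Ioi, hs, if_true, Pi.one_apply, ← ENNReal.ofReal_one]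
      exact ENNReal.ofReal_le_ofReal (by linarith)
    · simp [indicator, hs]
  refine Measure.ext_of_generateFrom_of_iUnion (range Ioi) (fun n : ℕ => Ioi (-n : ℝ))
    (by rw [← borel_eq_generateFrom_Ioi]; exact BorelSpace.measurable_eq)
    isPiSystem_Ioi ?_ (fun n => mem_range_self _) (fun n => hIoi_top _) ?_
  · refine eq_univ_of_forall fun x => mem_iUnion.2 ?_
    obtain ⟨n, hn⟩ := exists_nat_gt (-x)
    exact ⟨n, by simp only [mem_Ioi]; linarith⟩
  · rintro _ ⟨k, rfl⟩
    exact hIoi k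

theorem ext_of_call {μ ν : Measure ℝ} [IsFiniteMeasure μ] [IsFiniteMeasure ν]
    (hμ : FiniteFirstMoment μ) (hν : FiniteFirstMoment ν) (h : ∀ x, call μ x = call ν x) :
    μ = ν :=
  ext_of_lintegral_call (fun x => by rw [ofReal_call hμ, ofReal_call hν, h])
    fun x => by rw [ofReal_call hν]; exact ENNReal.ofReal_ne_top

/-- Every nonnegative convex function vanishing at `+∞` is the call function of a measure: the
limit `a → ∞` of the Taylor formula with base point `a`, in which the supporting line disappears.
-/
theorem ConvexOn.exists_measure_call {h : ℝ → ℝ} (hc : ConvexOn ℝ univ h) (h0 : ∀ x, 0 ≤ h x)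
    (hlim : Tendsto h atTop (𝓝 0)) :
    ∃ ρ : Measure ℝ, ∀ x, ∫⁻ s, ENNReal.ofReal (s - x) ∂ρ = ENNReal.ofReal (h x) := by
  obtain ⟨G, hG⟩ := hc.exists_lintegral_kernel
  refine ⟨G.measure, fun x => ?_⟩
  have hGneg : ∀ a, G a ≤ 0 := by
    intro a
    by_contra! ha
    have h1 : Tendsto (fun b => h a + G a * (b - a)) atTop atTop :=
      tendsto_atTop_add_const_left _ _
        ((tendsto_atTop_add_const_right _ (-a) tendsto_id).const_mul_atTop ha)
    obtain ⟨b, hb1, hb2⟩ :=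
      ((h1.eventually_ge_atTop 1).and (hlim.eventually_lt_const one_pos)).exists
    linarith [(hG a b).1]
  -- The supporting line at `n`, evaluated at the midpoint of `x` and `n`, bounds the slope `G n`.
  have hprod : Tendsto (fun n : ℕ => G n * (x - n)) atTop (𝓝 0) := by
    have hmid : Tendsto (fun n : ℕ => (x + n) / 2) atTop atTop :=
      (tendsto_atTop_add_const_left _ x tendsto_natCast_atTop_atTop).atTop_div_const two_pos
    have hup : Tendsto (fun n : ℕ => 2 * h ((x + n) / 2)) atTop (𝓝 0) := by
      simpa using (hlim.comp hmid).const_mul 2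
    refine tendsto_of_tendsto_of_tendsto_of_le_of_le' tendsto_const_nhds hup ?_ ?_
    · filter_upwards [tendsto_natCast_atTop_atTop.eventually_ge_atTop x] with n hn
      exact mul_nonneg_of_nonpos_of_nonpos (hGneg n) (by linarith)
    · refine Eventually.of_forall fun n => ?_
      have := (hG n ((x + n) / 2)).1
      linarith [h0 n]
  have lim1 : Tendsto (fun n : ℕ =>
      ∫⁻ s, (Iic (n : ℝ)).indicator (fun s => ENNReal.ofReal (s - x)) s ∂G.measure) atTop
      (𝓝 (∫⁻ s, ENNReal.ofReal (s - x) ∂G.measure)) := by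
    refine lintegral_tendsto_of_tendsto_of_monotone
      (fun n => (Measurable.indicator (by fun_prop) measurableSet_Iic).aemeasurable)
      (ae_of_all _ fun s n m hnm => ?_) (ae_of_all _ fun s => ?_)
    · exact indicator_le_indicator_of_subset (Iic_subset_Iic.2 (by exact_mod_cast hnm))
        (fun _ => zero_le) s
    · refine tendsto_const_nhds.congr' ?_
      filter_upwards [tendsto_natCast_atTop_atTop.eventually_ge_atTop s] with n hn
      rw [indicator_of_mem (by exact hn)]
  have lim2 : Tendsto (fun n : ℕ => ENNReal.ofReal (h x - h n - G n * (x - n))) atTop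
      (𝓝 (ENNReal.ofReal (h x))) := by
    refine ENNReal.tendsto_ofReal ?_
    simpa using (tendsto_const_nhds.sub (hlim.comp tendsto_natCast_atTop_atTop)).sub hprod
  refine tendsto_nhds_unique lim1 (lim2.congr' ?_)
  filter_upwards [tendsto_natCast_atTop_atTop.eventually_ge_atTop x] with n hn
  rw [← (hG n x).2]
  refine lintegral_congr fun s => ?_
  by_cases hs : (n : ℝ) < s
  · rw [if_pos hs, indicator_of_notMem (by simpa using hs), ENNReal.ofReal_of_nonpos (by linarith)]
  · rw [if_neg hs, indicator_of_mem (by simpa using hs)]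

/-! ### The convex order in terms of call functions -/

/-- Put-call parity: the integral of `x ↦ (s - x)⁺` is determined by the call function, the mean
and the mass. -/
theorem lintegral_put {μ : Measure ℝ} [IsFiniteMeasure μ] (hμ : FiniteFirstMoment μ) (s : ℝ) :
    ∫⁻ x, ENNReal.ofReal (s - x) ∂μ =
      ENNReal.ofReal (call μ s - ∫ x, x ∂μ + μ.real univ * s) := by
  have hid : Integrable (fun x : ℝ => x) μ := hμ
  have h1 : Integrable (fun x => max (x - s) 0 - x) μ := (hμ.integrable_call s).sub hid
  have h2 : Integrable (fun x => max (x - s) 0 - x + s) μ := h1.add (integrable_const s)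
  have e : call μ s - ∫ x, x ∂μ + μ.real univ * s = ∫ x, (max (x - s) 0 - x + s) ∂μ := by
    rw [integral_add h1 (integrable_const s),
      integral_sub (hμ.integrable_call s) hid]
    simp [call]
  rw [e, ofReal_integral_eq_lintegral_ofReal h2]
  · refine lintegral_congr fun x => ?_
    rcases le_total x s with h | h
    · rw [max_eq_right (by linarith)]; congr 1; ring
    · rw [max_eq_left (by linarith), ENNReal.ofReal_of_nonpos (by linarith)]; simp
  · refine ae_of_all _ fun x => ?_
    change 0 ≤ max (x - s) 0 - x + s
    linarith [le_max_left (x - s) 0]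

/-- Equal mass, equal mean and ordered call functions imply the convex order, since convex
functions are mixtures of affine functions, calls and puts. -/
theorem convexOrder_of_call {μ ν : Measure ℝ} [IsFiniteMeasure μ] [IsFiniteMeasure ν]
    (hμ : FiniteFirstMoment μ) (hν : FiniteFirstMoment ν) (hmass : μ.real univ = ν.real univ)
    (hmean : ∫ x, x ∂μ = ∫ x, x ∂ν) (hcall : ∀ x, call μ x ≤ call ν x) : ConvexOrder μ ν := by
  intro φ hφ hint
  obtain ⟨G, hG⟩ := hφ.exists_lintegral_kernel
  replace hG := hG 0
  simp only [sub_zero] at hG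
  have hφc := hφ.continuous_of_univ
  set ψ : ℝ → ℝ := fun x => φ x - φ 0 - G 0 * x with hψ
  have hψ0 : ∀ x, 0 ≤ ψ x := fun x => by simp only [hψ]; linarith [(hG x).1]
  have hψc : Continuous ψ := by fun_prop
  have hker : ∀ s, Measurable fun x : ℝ => ENNReal.ofReal (if 0 < s then x - s else s - x) := by
    intro s; split_ifs <;> fun_prop
  have hker2 : Measurable fun p : ℝ × ℝ =>
      ENNReal.ofReal (if 0 < p.2 then p.1 - p.2 else p.2 - p.1) :=
    ENNReal.measurable_ofReal.comp (Measurable.ite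
      (measurableSet_lt measurable_const measurable_snd) (by fun_prop) (by fun_prop))
  have tonelli : ∀ (ρ : Measure ℝ) [IsFiniteMeasure ρ], ∫⁻ x, ENNReal.ofReal (ψ x) ∂ρ =
      ∫⁻ s, (∫⁻ x, ENNReal.ofReal (if 0 < s then x - s else s - x) ∂ρ) ∂G.measure := by
    intro ρ _
    rw [← lintegral_lintegral_swap hker2.aemeasurable]
    exact lintegral_congr fun x => (hG x).2.symm
  have hle : ∫⁻ x, ENNReal.ofReal (ψ x) ∂μ ≤ ∫⁻ x, ENNReal.ofReal (ψ x) ∂ν := by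
    rw [tonelli μ, tonelli ν]
    refine lintegral_mono fun s => ?_
    by_cases hs : 0 < s
    · simp only [hs, if_true]
      rw [ofReal_call hμ, ofReal_call hν]
      exact ENNReal.ofReal_le_ofReal (hcall s)
    · simp only [hs, if_false]
      rw [lintegral_put hμ, lintegral_put hν, hmass, hmean]
      exact ENNReal.ofReal_le_ofReal (by linarith [hcall s])
  have hlin : ∀ (ρ : Measure ℝ) [IsFiniteMeasure ρ], FiniteFirstMoment ρ →
      Integrable (fun x => φ 0 + G 0 * x) ρ := fun ρ _ hρ =>
    (integrable_const _).add (Integrable.const_mul hρ _)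
  have hψν : Integrable ψ ν := by
    refine (hint.sub (hlin ν hν)).congr (ae_of_all _ fun x => ?_)
    simp only [hψ, Pi.sub_apply]; ring
  have hψμ : Integrable ψ μ := by
    refine ⟨hψc.aestronglyMeasurable, ?_⟩
    rw [hasFiniteIntegral_iff_ofReal (ae_of_all _ hψ0)]
    refine hle.trans_lt ?_
    rw [← hasFiniteIntegral_iff_ofReal (ae_of_all _ hψ0)]
    exact hψν.2
  have hψle : ∫ x, ψ x ∂μ ≤ ∫ x, ψ x ∂ν := by
    rw [integral_eq_lintegral_of_nonneg_ae (ae_of_all _ hψ0) hψc.aestronglyMeasurable,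
      integral_eq_lintegral_of_nonneg_ae (ae_of_all _ hψ0) hψc.aestronglyMeasurable]
    refine ENNReal.toReal_mono ?_ hle
    rw [← lt_top_iff_ne_top, ← hasFiniteIntegral_iff_ofReal (ae_of_all _ hψ0)]
    exact hψν.2
  have hφψ : φ = fun x => ψ x + (φ 0 + G 0 * x) := by
    ext x; simp only [hψ]; ring
  have hval : ∀ (ρ : Measure ℝ) [IsFiniteMeasure ρ], FiniteFirstMoment ρ → Integrable ψ ρ →
      ∫ x, φ x ∂ρ = ∫ x, ψ x ∂ρ + (φ 0 * ρ.real univ + G 0 * ∫ x, x ∂ρ) := by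
    intro ρ _ hρ hψρ
    conv_lhs => rw [hφψ]
    rw [integral_add hψρ (hlin ρ hρ), integral_add (integrable_const _)
      (Integrable.const_mul hρ _), integral_const_mul]
    simp [mul_comm]
  refine ⟨by rw [hφψ]; exact hψμ.add (hlin μ hμ), ?_⟩
  rw [hval μ hμ hψμ, hval ν hν hψν, hmass, hmean]
  linarith

theorem ConvexOrder.real_univ_eq {μ ν : Measure ℝ} [IsFiniteMeasure ν]
    (h : ConvexOrder μ ν) : μ.real univ = ν.real univ := by
  have h1 := (h (fun _ => 1) (convexOn_const _ convex_univ) (integrable_const _)).2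
  have h2 := (h (fun _ => -1) (convexOn_const _ convex_univ) (integrable_const _)).2
  simp at h1 h2
  linarith

theorem ConvexOrder.integral_id_eq {μ ν : Measure ℝ}
    (hν : FiniteFirstMoment ν) (h : ConvexOrder μ ν) : ∫ x, x ∂μ = ∫ x, x ∂ν := by
  have h1 := (h (fun x => x) (convexOn_id convex_univ) hν).2
  have h2 := (h (fun x => -x) (concaveOn_id convex_univ).neg (Integrable.neg hν)).2
  rw [integral_neg, integral_neg] at h2
  exact le_antisymm h1 (by linarith)

theorem ConvexOrder.call_le {μ ν : Measure ℝ} [IsFiniteMeasure ν]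
    (hν : FiniteFirstMoment ν) (h : ConvexOrder μ ν) (x : ℝ) : call μ x ≤ call ν x :=
  (h _ (convexOn_sub_max x) (hν.integrable_call x)).2

theorem ConvexOrder.antisymm {μ ν : Measure ℝ} [IsFiniteMeasure μ] [IsFiniteMeasure ν]
    (hμ : FiniteFirstMoment μ) (hν : FiniteFirstMoment ν) (h : ConvexOrder μ ν)
    (h' : ConvexOrder ν μ) : μ = ν :=
  ext_of_call hμ hν fun x => (h.call_le hν x).antisymm (h'.call_le hμ x)

/-- The mass is the asymptotic slope of the call function at `-∞`. -/
theorem real_univ_le_of_call_le {μ ν : Measure ℝ} [IsFiniteMeasure μ] [IsFiniteMeasure ν]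
    (hμ : FiniteFirstMoment μ) (hν : FiniteFirstMoment ν) (hcall : ∀ x, call μ x ≤ call ν x) :
    μ.real univ ≤ ν.real univ := by
  refine le_of_tendsto_of_tendsto (tendsto_call_div_atBot hμ) (tendsto_call_div_atBot hν) ?_
  filter_upwards [eventually_lt_atBot 0] with x hx
  exact div_le_div_of_nonneg_right (hcall x) (by linarith)

theorem integral_id_le_of_call_le {μ ν : Measure ℝ} [IsFiniteMeasure μ] [IsFiniteMeasure ν]
    (hμ : FiniteFirstMoment μ) (hν : FiniteFirstMoment ν) (hmass : μ.real univ = ν.real univ)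
    (hcall : ∀ x, call μ x ≤ call ν x) : ∫ x, x ∂μ ≤ ∫ x, x ∂ν := by
  refine le_of_tendsto_of_tendsto' (tendsto_call_add_atBot hμ) (tendsto_call_add_atBot hν) ?_
  intro x
  rw [hmass]
  linarith [hcall x]

/-! ### The greatest convex minorant of a difference of convex functions -/

theorem ConvexOn.secant_le_of_notMem_Icc {h : ℝ → ℝ} (hh : ConvexOn ℝ univ h) {a b t : ℝ}
    (hab : a < b) (ht : t ∉ Icc a b) : h a + (h b - h a) / (b - a) * (t - a) ≤ h t := by
  have hm : (h b - h a) / (b - a) * (b - a) = h b - h a := div_mul_cancel₀ _ (by linarith)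
  rcases lt_or_ge t a with hta | hta
  · have := hh.slope_mono_adjacent (mem_univ t) (mem_univ b) hta hab
    rw [div_le_iff₀ (by linarith)] at this
    linarith
  · have hbt : b < t := by by_contra! hc; exact ht ⟨hta, hc⟩
    have := hh.slope_mono_adjacent (mem_univ a) (mem_univ t) hab hbt
    rw [le_div_iff₀ (by linarith)] at this
    linarith

/-- The greatest convex minorant `h` of a difference `g - k` of convex functions has the property
that `g - h` is again convex: where `h < g - k`, the function `h` is locally affine, and where
`h = g - k`, the function `g - h` equals `k`. -/
theorem ConvexOn.exists_greatest_minorant_sub {g k : ℝ → ℝ} (hg : ConvexOn ℝ univ g)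
    (hk : ConvexOn ℝ univ k) (hne : ∃ φ, ConvexOn ℝ univ φ ∧ ∀ x, φ x ≤ g x - k x) :
    ∃ h, ConvexOn ℝ univ h ∧ (∀ x, h x ≤ g x - k x) ∧
      (∀ φ, ConvexOn ℝ univ φ → (∀ x, φ x ≤ g x - k x) → ∀ x, φ x ≤ h x) ∧
      ConvexOn ℝ univ fun x => g x - h x := by
  let F := {φ : ℝ → ℝ // ConvexOn ℝ univ φ ∧ ∀ x, φ x ≤ g x - k x}
  have : Nonempty F := let ⟨φ, hφ⟩ := hne; ⟨⟨φ, hφ⟩⟩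
  have hbdd : ∀ x, BddAbove (range fun φ : F => φ.1 x) := fun x =>
    ⟨g x - k x, by rintro _ ⟨φ, rfl⟩; exact φ.2.2 x⟩
  obtain ⟨h, hdef⟩ : ∃ h : ℝ → ℝ, ∀ x, h x = ⨆ φ : F, φ.1 x := ⟨_, fun _ => rfl⟩
  have hconv : ConvexOn ℝ univ h := by
    refine ⟨convex_univ, fun x _ y _ a b ha hb hab => ?_⟩
    rw [hdef, hdef, hdef]
    refine ciSup_le fun φ => ?_
    refine (φ.2.1.2 (mem_univ x) (mem_univ y) ha hb hab).trans ?_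
    exact add_le_add (mul_le_mul_of_nonneg_left (le_ciSup (hbdd x) φ) ha)
      (mul_le_mul_of_nonneg_left (le_ciSup (hbdd y) φ) hb)
  have hle : ∀ x, h x ≤ g x - k x := fun x => by rw [hdef]; exact ciSup_le fun φ => φ.2.2 x
  have hmax : ∀ φ, ConvexOn ℝ univ φ → (∀ x, φ x ≤ g x - k x) → ∀ x, φ x ≤ h x :=
    fun φ h1 h2 x => by rw [hdef]; exact le_ciSup (hbdd x) (⟨φ, h1, h2⟩ : F)
  refine ⟨h, hconv, hle, hmax, ?_⟩
  have hgc := hg.continuous_of_univ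
  have hkc := hk.continuous_of_univ
  have hhc := hconv.continuous_of_univ
  refine LinearOrder.convexOn_of_lt convex_univ fun x _ y _ hxy a b ha hb hab => ?_
  -- If `g - h` exceeds its chord, of slope `m`, over `[x, y]`, let `w` be the excess and `p`
  -- its rightmost maximum point.
  by_contra! hcon
  simp only [smul_eq_mul] at hcon
  set z := a * x + b * y with hz
  set m := ((g y - h y) - (g x - h x)) / (y - x) with hm
  have hmyx : m * (y - x) = (g y - h y) - (g x - h x) := div_mul_cancel₀ _ (by linarith)
  set w : ℝ → ℝ := fun t => g t - h t - (g x - h x) - m * (t - x) with hw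
  have hwc : Continuous w := by fun_prop
  have hwx : w x = 0 := by simp [hw]
  have hwy : w y = 0 := by simp only [hw]; linarith
  have ha' : a = 1 - b := by linarith
  have hzx : z - x = b * (y - x) := by rw [hz, ha']; ring
  have hwz : 0 < w z := by
    simp only [hw]
    rw [hzx, show m * (b * (y - x)) = b * (m * (y - x)) by ring, hmyx]
    rw [ha'] at hcon
    linarith
  have hzmem : z ∈ Icc x y := by
    constructor
    · nlinarith
    · have : y - z = a * (y - x) := by rw [hz, ha']; ring
      nlinarith
  obtain ⟨q, hq, hqmax⟩ := isCompact_Icc.exists_isMaxOn ⟨z, hzmem⟩ hwc.continuousOn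
  have hScomp : IsCompact (Icc x y ∩ w ⁻¹' {w q}) :=
    isCompact_Icc.inter_right (isClosed_singleton.preimage hwc)
  obtain ⟨p, ⟨hp, hpq⟩, hpmax⟩ := hScomp.exists_isGreatest ⟨q, hq, rfl⟩
  have hpq' : w p = w q := hpq
  have hwp : 0 < w p := by rw [hpq']; exact hwz.trans_le (hqmax hzmem)
  have hxp : x < p := lt_of_le_of_ne hp.1 (by rintro rfl; linarith)
  have hpy : p < y := lt_of_le_of_ne hp.2 (by rintro rfl; linarith)
  -- There `k` lies below the chord of `g - h`, so that `h` has room to move up.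
  have hhp : h p < g p - k p := by
    have hkx : k x ≤ g x - h x := by linarith [hle x]
    have hky : k y ≤ g y - h y := by linarith [hle y]
    have hyx : 0 < y - x := by linarith
    have hk' := hk.2 (mem_univ x) (mem_univ y) 
      (div_nonneg (by linarith : 0 ≤ y - p) hyx.le) (div_nonneg (by linarith : 0 ≤ p - x) hyx.le)
      (by field_simp; ring)
    simp only [smul_eq_mul] at hk'
    have e1 : (y - p) / (y - x) * x + (p - x) / (y - x) * y = p := by field_simp; ring
    rw [e1] at hk'
    have h1 := mul_le_mul_of_nonneg_left hkx (div_nonneg (by linarith : 0 ≤ y - p) hyx.le)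
    have h2 := mul_le_mul_of_nonneg_left hky (div_nonneg (by linarith : 0 ≤ p - x) hyx.le)
    have e2 : (y - p) / (y - x) * (g x - h x) + (p - x) / (y - x) * (g y - h y) =
        (g x - h x) + m * (p - x) := by
      rw [hm]; field_simp; ring
    simp only [hw] at hwp
    linarith
  obtain ⟨c, hc1, hc2⟩ := exists_between hhp
  have hev : ∀ᶠ t in 𝓝 p, h t < c ∧ c < g t - k t ∧ x < t ∧ t < y :=
    (hhc.continuousAt.eventually_lt_const hc1).and
      (((hgc.sub hkc).continuousAt.eventually_const_lt hc2).and
        ((lt_mem_nhds hxp).and (gt_mem_nhds hpy)))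
  obtain ⟨δ, hδ, hball⟩ := Metric.nhds_basis_closedBall.eventually_iff.1 hev
  rw [Real.closedBall_eq_Icc] at hball
  have hlt : p - δ < p + δ := by linarith
  have hA := hball (left_mem_Icc.2 hlt.le)
  have hB := hball (right_mem_Icc.2 hlt.le)
  set r := (h (p + δ) - h (p - δ)) / ((p + δ) - (p - δ)) with hr
  have hrm : r * ((p + δ) - (p - δ)) = h (p + δ) - h (p - δ) := div_mul_cancel₀ _ (by linarith)
  -- Replacing `h` by its chord on `[p - δ, p + δ]` gives a convex minorant, hence nothing new:
  -- `h` is affine there, so `w` is convex there and takes its maximum also at `p + δ`.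
  have hφ : ConvexOn ℝ univ fun t => max (h t) (h (p - δ) + r * (t - (p - δ))) := by
    refine hconv.sup ?_
    refine ⟨convex_univ, fun s _ t _ a b _ _ hab => le_of_eq ?_⟩
    simp only [smul_eq_mul]
    have : a = 1 - b := by linarith
    rw [this]; ring
  have hsec := hmax _ hφ (fun t => by
    refine max_le (hle t) ?_
    by_cases ht : t ∈ Icc (p - δ) (p + δ)
    · refine le_trans ?_ (hball ht).2.1.le
      have h1 : 0 ≤ t - (p - δ) := by linarith [ht.1]
      have h2 : t - (p - δ) ≤ 2 * δ := by linarith [ht.2]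
      rcases le_total 0 r with h0 | h0
      · nlinarith [hB.1]
      · nlinarith [hA.1]
    · exact (hconv.secant_le_of_notMem_Icc hlt ht).trans (hle t)) p
  have hsec' := (le_max_right _ _).trans hsec
  have hgp := hg.2 (mem_univ (p - δ)) (mem_univ (p + δ)) 
    (by norm_num : (0 : ℝ) ≤ 1 / 2) (by norm_num : (0 : ℝ) ≤ 1 / 2) (by norm_num)
  simp only [smul_eq_mul] at hgp
  have e3 : 1 / 2 * (p - δ) + 1 / 2 * (p + δ) = p := by ring
  rw [e3] at hgp
  have hpδ : p + δ ∈ Icc x y := ⟨hB.2.2.1.le, hB.2.2.2.le⟩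
  have hw1 : w (p - δ) ≤ w q := hqmax (show p - δ ∈ Icc x y from ⟨hA.2.2.1.le, hA.2.2.2.le⟩)
  have hw2 : w (p + δ) ≤ w q := hqmax hpδ
  have hwavg : w p ≤ (w (p - δ) + w (p + δ)) / 2 := by
    simp only [hw]
    linarith
  have : p + δ ≤ p := hpmax ⟨hpδ, show w (p + δ) = w q by linarith⟩
  linarith

/-! ### Existence of shadows -/

/-- Existence of the shadow `η` of `μ₁` in `ν`, together with the fact that what remains of `ν`
still dominates `μ₂`. With `h` the greatest convex minorant of `call ν - call μ₁`, the call
functions are `call ν - h` for `η` and `h` for the remainder: every `η' ≤ ν` above `μ₁` in the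
convex order gives a convex minorant `call ν - call η'`, and `call μ₂` is another one. -/
theorem exists_isShadow_add {μ₁ μ₂ ν : Measure ℝ} [IsFiniteMeasure μ₁] [IsFiniteMeasure μ₂]
    [IsFiniteMeasure ν] (hμ₁ : FiniteFirstMoment μ₁) (hμ₂ : FiniteFirstMoment μ₂)
    (hν : FiniteFirstMoment ν) (hle : ConvexOrder (μ₁ + μ₂) ν) :
    ∃ η ρ : Measure ℝ, η + ρ = ν ∧ IsShadow ν μ₁ η ∧ ConvexOrder μ₂ ρ := by
  have hcall₂ : ∀ x, call μ₂ x ≤ call ν x - call μ₁ x := fun x => by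
    have := hle.call_le hν x
    rw [call_add_measure hμ₁ hμ₂] at this
    linarith
  obtain ⟨h, hconv, hhle, hmax, hsub⟩ := (convexOn_call hν).exists_greatest_minorant_sub
    (convexOn_call hμ₁) ⟨call μ₂, convexOn_call hμ₂, hcall₂⟩
  have hμ₂h := hmax _ (convexOn_call hμ₂) hcall₂
  have hh0 : ∀ x, 0 ≤ h x := fun x => (call_nonneg μ₂ x).trans (hμ₂h x)
  have hu : ∀ x, call μ₁ x ≤ call ν x - h x := fun x => by linarith [hhle x]
  have hu0 : ∀ x, 0 ≤ call ν x - h x := fun x => (call_nonneg μ₁ x).trans (hu x)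
  obtain ⟨ρ, hρ⟩ := hconv.exists_measure_call hh0
    (squeeze_zero hh0 (fun x => by linarith [hu0 x]) (tendsto_call_atTop hν))
  obtain ⟨η, hη⟩ := hsub.exists_measure_call hu0
    (squeeze_zero hu0 (fun x => by linarith [hh0 x]) (tendsto_call_atTop hν))
  have hsum : η + ρ = ν := by
    refine ext_of_lintegral_call (fun x => ?_) fun x => by
      rw [ofReal_call hν]; exact ENNReal.ofReal_ne_top
    rw [lintegral_add_measure, hη, hρ, ← ENNReal.ofReal_add (hu0 x) (hh0 x), ofReal_call hν]
    congr 1; ring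
  have hην : η ≤ ν := hsum ▸ Measure.le_add_right le_rfl
  have hρν : ρ ≤ ν := hsum ▸ Measure.le_add_left le_rfl
  have : IsFiniteMeasure η := isFiniteMeasure_of_le ν hην
  have : IsFiniteMeasure ρ := isFiniteMeasure_of_le ν hρν
  have hηm := hν.mono hην
  have hρm := hν.mono hρν
  have cη : ∀ x, call η x = call ν x - h x := fun x => by
    have := hη x
    rwa [ofReal_call hηm, ENNReal.ofReal_eq_ofReal_iff (call_nonneg _ _) (hu0 x)] at this
  have cρ : ∀ x, call ρ x = h x := fun x => by
    have := hρ x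
    rwa [ofReal_call hρm, ENNReal.ofReal_eq_ofReal_iff (call_nonneg _ _) (hh0 x)] at this
  have c1 : ∀ x, call μ₁ x ≤ call η x := fun x => by rw [cη]; exact hu x
  have c2 : ∀ x, call μ₂ x ≤ call ρ x := fun x => by rw [cρ]; exact hμ₂h x
  -- Both parts gain mass and mean, and the totals agree.
  have mass1 := real_univ_le_of_call_le hμ₁ hηm c1
  have mass2 := real_univ_le_of_call_le hμ₂ hρm c2
  have mass := hle.real_univ_eq
  rw [← hsum, measureReal_add_apply, measureReal_add_apply] at mass
  have mass1' : μ₁.real univ = η.real univ := by linarith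
  have mass2' : μ₂.real univ = ρ.real univ := by linarith
  have mean1 := integral_id_le_of_call_le hμ₁ hηm mass1' c1
  have mean2 := integral_id_le_of_call_le hμ₂ hρm mass2' c2
  have mean := hle.integral_id_eq hν
  rw [← hsum, integral_add_measure hμ₁ hμ₂, integral_add_measure hηm hρm] at mean
  refine ⟨η, ρ, hsum, ⟨convexOrder_of_call hμ₁ hηm mass1' (by linarith) c1, hην, ?_⟩,
    convexOrder_of_call hμ₂ hρm mass2' (by linarith) c2⟩
  intro η' hη' hη'ν
  have : IsFiniteMeasure η' := isFiniteMeasure_of_le ν hη'ν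
  have hη'm := hν.mono hη'ν
  have hadd : ν - η' + η' = ν := Measure.sub_add_cancel_of_le hη'ν
  have hdm : FiniteFirstMoment (ν - η') := hν.mono Measure.sub_le
  have cd : ∀ x, call (ν - η') x = call ν x - call η' x := fun x => by
    have := call_add_measure hdm hη'm x
    rw [hadd] at this
    linarith
  have cη' : ∀ x, call (ν - η') x ≤ h x := hmax _ (convexOn_call hdm) fun x => by
    rw [cd]
    linarith [hη'.call_le hη'm x]
  refine convexOrder_of_call hηm hη'm ?_ ?_ fun x => ?_
  · rw [← mass1', hη'.real_univ_eq]
  · rw [← hη'.integral_id_eq hη'm]; linarith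
  · rw [cη]
    linarith [cη' x, cd x]

theorem IsShadow.shadow_eq {μ ν η : Measure ℝ} [IsFiniteMeasure ν] (hν : FiniteFirstMoment ν)
    (h : IsShadow ν μ η) : shadow ν μ = η := by
  have hex : ∃ η, IsShadow ν μ η := ⟨η, h⟩
  have hs : IsShadow ν μ (shadow ν μ) := by
    rw [shadow, dif_pos hex]; exact hex.choose_spec
  have : IsFiniteMeasure η := isFiniteMeasure_of_le ν h.le
  have : IsFiniteMeasure (shadow ν μ) := isFiniteMeasure_of_le ν hs.le
  exact (hs.min _ h.convexOrder h.le).antisymm (hν.mono hs.le) (hν.mono h.le)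
    (h.min _ hs.convexOrder hs.le)

/-- `exists_isShadow_add` in terms of the chosen shadow, by uniqueness. -/
theorem isShadow_shadow_and_convexOrder_sub {μ₁ μ₂ ν : Measure ℝ} [IsFiniteMeasure μ₁]
    [IsFiniteMeasure μ₂] [IsFiniteMeasure ν] (hμ₁ : FiniteFirstMoment μ₁)
    (hμ₂ : FiniteFirstMoment μ₂) (hν : FiniteFirstMoment ν) (hle : ConvexOrder (μ₁ + μ₂) ν) :
    IsShadow ν μ₁ (shadow ν μ₁) ∧ ∃ ρ, shadow ν μ₁ + ρ = ν ∧ ConvexOrder μ₂ ρ := by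
  obtain ⟨η, ρ, hsum, hη, hρ⟩ := exists_isShadow_add hμ₁ hμ₂ hν hle
  rw [hη.shadow_eq hν]
  exact ⟨hη, ρ, hsum, hρ⟩

open CompactlySupported

/-! ### Strassen's theorem: the dual inequality and the extended functional -/


/-- The easy half of martingale transport duality: the supremum `Φ` of the affine functions
`y ↦ -ψ x - h x * (y - x)` is convex and satisfies `-ψ ≤ Φ ≤ φ`. No regularity of `h`
is needed. -/
theorem ConvexOrder.integral_add_nonneg {μ ν : Measure ℝ} [IsFiniteMeasure ν]
    (hν : FiniteFirstMoment ν) (hle : ConvexOrder μ ν) {φ ψ h : ℝ → ℝ}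
    (hφ : Integrable φ ν) (hψ : Integrable ψ μ)
    (hpos : ∀ x y, 0 ≤ φ y + ψ x + h x * (y - x)) : 0 ≤ ∫ y, φ y ∂ν + ∫ x, ψ x ∂μ := by
  have hbdd : ∀ y, BddAbove (range fun x => -ψ x - h x * (y - x)) := fun y =>
    ⟨φ y, by rintro _ ⟨x, rfl⟩; have := hpos x y; change -ψ x - h x * (y - x) ≤ φ y; linarith⟩
  obtain ⟨Φ, hΦ⟩ : ∃ Φ : ℝ → ℝ, ∀ y, Φ y = ⨆ x, (-ψ x - h x * (y - x)) := ⟨_, fun _ => rfl⟩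
  have hge : ∀ x y, -ψ x - h x * (y - x) ≤ Φ y := fun x y => by
    rw [hΦ]; exact le_ciSup (hbdd y) x
  have hconv : ConvexOn ℝ univ Φ := by
    refine ⟨convex_univ, fun y _ z _ a b ha hb hab => ?_⟩
    rw [hΦ]
    refine ciSup_le fun x => ?_
    have h1 := mul_le_mul_of_nonneg_left (hge x y) ha
    have h2 := mul_le_mul_of_nonneg_left (hge x z) hb
    simp only [smul_eq_mul]
    have : b = 1 - a := by linarith
    subst this
    linarith
  have hΦφ : ∀ y, Φ y ≤ φ y := fun y => by
    rw [hΦ]; exact ciSup_le fun x => by linarith [hpos x y]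
  have hlow : Integrable (fun y => -ψ 0 - h 0 * (y - 0)) ν :=
    (integrable_const _).sub ((Integrable.sub hν (integrable_const _)).const_mul _)
  have hΦν : Integrable Φ ν := by
    refine (hlow.abs.add hφ.abs).mono' hconv.continuous_of_univ.aestronglyMeasurable
      (ae_of_all _ fun y => ?_)
    rw [Real.norm_eq_abs, abs_le, Pi.add_apply]
    constructor
    · linarith [neg_abs_le (-ψ 0 - h 0 * (y - 0)), hge 0 y, abs_nonneg (φ y)]
    · linarith [le_abs_self (φ y), hΦφ y, abs_nonneg (-ψ 0 - h 0 * (y - 0))]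
  obtain ⟨hΦμ, hint⟩ := hle Φ hconv hΦν
  have h1 : ∫ y, Φ y ∂ν ≤ ∫ y, φ y ∂ν := integral_mono hΦν hφ hΦφ
  have h2 : ∫ x, -ψ x ∂μ ≤ ∫ x, Φ x ∂μ := integral_mono hψ.neg hΦμ fun x => by
    have := hge x x
    simpa using this
  rw [integral_neg] at h2
  linarith

/-- The functional `(φ, ψ, h) ↦ ∫ φ dν + ∫ ψ dμ` is nonnegative where `φ y + ψ x + h x * (y - x)`
is. The M. Riesz extension theorem extends it to a functional that is also defined on `C_c(ℝ × ℝ,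
ℝ)`, and the Riesz-Markov-Kakutani theorem represents this one by a measure. -/
theorem ConvexOrder.exists_measure_integral_le {μ ν : Measure ℝ} [IsFiniteMeasure ν]
    (hν : FiniteFirstMoment ν) (hle : ConvexOrder μ ν) :
    ∃ π : Measure (ℝ × ℝ), IsFiniteMeasureOnCompacts π ∧ ∀ (F : C_c(ℝ × ℝ, ℝ)) (φ ψ h : ℝ → ℝ),
      Integrable φ ν → Integrable ψ μ → (∀ x y, F (x, y) ≤ φ y + ψ x + h x * (y - x)) →
      ∫ p, F p ∂π ≤ ∫ y, φ y ∂ν + ∫ x, ψ x ∂μ := by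
  -- Triples and test functions are kept as separate components: the triple `w` need not be
  -- determined by the function `φ y + ψ x + h x * (y - x)`.
  let W : Submodule ℝ ((ℝ → ℝ) × (ℝ → ℝ) × (ℝ → ℝ)) :=
    { carrier := {w | Integrable w.1 ν ∧ Integrable w.2.1 μ}
      add_mem' := fun ha hb => ⟨ha.1.add hb.1, ha.2.add hb.2⟩
      zero_mem' := ⟨integrable_zero _ _ _, integrable_zero _ _ _⟩
      smul_mem' := fun c _ hw => ⟨hw.1.smul c, hw.2.smul c⟩ }
  let ℓ : W →ₗ[ℝ] ℝ :=
    { toFun := fun w => ∫ y, w.1.1 y ∂ν + ∫ x, w.1.2.1 x ∂μ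
      map_add' := fun v w => by
        have h1 := integral_add v.2.1 w.2.1
        have h2 := integral_add v.2.2 w.2.2
        simp only [Submodule.coe_add, Prod.fst_add, Prod.snd_add, Pi.add_apply]
        rw [h1, h2]; ring
      map_smul' := fun c w => by
        simp only [Submodule.coe_smul, Prod.smul_fst, Prod.smul_snd, Pi.smul_apply, smul_eq_mul,
          integral_const_mul, RingHom.id_apply]
        ring }
  let s : PointedCone ℝ (W × C_c(ℝ × ℝ, ℝ)) :=
    { carrier := {p | ∀ x y, 0 ≤ p.1.1.1 y + p.1.1.2.1 x + p.1.1.2.2 x * (y - x) + p.2 (x, y)}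
      add_mem' := fun {p q} hp hq x y => by
        have h1 := hp x y
        have h2 := hq x y
        simp only [Prod.fst_add, Prod.snd_add, Submodule.coe_add, Pi.add_apply,
          CompactlySupportedContinuousMap.coe_add]
        linarith
      zero_mem' := fun x y => by simp
      smul_mem' := fun c p hp x y => by
        have h1 := mul_nonneg c.2 (hp x y)
        have e : ∀ v : ℝ, c • v = (c : ℝ) * v := fun _ => rfl
        have e2 : (c • p.2) (x, y) = (c : ℝ) * p.2 (x, y) := rfl
        simp only [Prod.smul_fst, Submodule.coe_smul_of_tower, Prod.smul_snd, Pi.smul_apply, e, e2]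
        linarith }
  let f : (W × C_c(ℝ × ℝ, ℝ)) →ₗ.[ℝ] ℝ :=
    { domain := LinearMap.ker (LinearMap.snd ℝ W C_c(ℝ × ℝ, ℝ))
      toFun := ℓ.comp ((LinearMap.fst ℝ W C_c(ℝ × ℝ, ℝ)).comp (Submodule.subtype _)) }
  obtain ⟨g, hgf, hgs⟩ := riesz_extension s f
    (by
      rintro ⟨⟨w, F⟩, hF⟩ hs
      obtain rfl : F = 0 := by simpa [f] using hF
      exact hle.integral_add_nonneg hν w.2.1 w.2.2 (h := w.1.2.2) fun x y => by
        simpa using hs x y)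
    (by
      rintro ⟨w, F⟩
      obtain ⟨C, hC⟩ := F.hasCompactSupport.exists_bound_of_continuous F.continuous
      let c : W := ⟨(fun _ => C, 0, 0), integrable_const _, integrable_zero _ _ _⟩
      refine ⟨⟨(c - w, 0), by simp [f]⟩, fun x y => ?_⟩
      have := (abs_le.1 (hC (x, y))).1
      simp [c]
      linarith)
  let Λ : C_c(ℝ × ℝ, ℝ) →ₚ[ℝ] ℝ := PositiveLinearMap.mk₀
    (g.comp (LinearMap.inr ℝ W C_c(ℝ × ℝ, ℝ))) fun F hF => hgs _ fun x y => by
      simpa using hF (x, y)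
  have hΛ : ∀ F, Λ F = g (0, F) := fun _ => rfl
  refine ⟨RealRMK.rieszMeasure Λ, inferInstance, fun F φ ψ h hφ hψ hF => ?_⟩
  rw [RealRMK.integral_rieszMeasure, hΛ]
  let w : W := ⟨(φ, ψ, h), hφ, hψ⟩
  have h1 : 0 ≤ g (w, -F) := hgs _ fun x y => by
    have := hF x y
    simp [w]
    linarith
  have h2 : g (w, 0) = ∫ y, φ y ∂ν + ∫ x, ψ x ∂μ := hgf ⟨(w, 0), by simp [f]⟩
  have h3 : g (w, -F) = g (w, 0) - g (0, F) := by
    rw [← map_sub]; simp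
  linarith

/-! ### Strassen's theorem: existence of martingale couplings -/

/-- `π` is a martingale coupling of the measures `μ` and `ν`, of arbitrary mass: its marginals are
`μ` and `ν`, and `E[Y - X; X ∈ A] = 0` for all Borel sets `A`. -/
structure IsMartingaleCoupling (π : Measure (ℝ × ℝ)) (μ ν : Measure ℝ) : Prop where
  map_fst : π.map Prod.fst = μ
  map_snd : π.map Prod.snd = ν
  setIntegral_eq : ∀ A, MeasurableSet A →
    ∫ p in Prod.fst ⁻¹' A, p.2 ∂π = ∫ p in Prod.fst ⁻¹' A, p.1 ∂π

/-- A continuous cutoff: `1` on `[-n, n]`, `0` outside `[-n - 1, n + 1]`. -/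
noncomputable def cutoff (n : ℕ) (t : ℝ) : ℝ := max 0 (min 1 (n + 1 - |t|))

theorem continuous_cutoff (n : ℕ) : Continuous (cutoff n) := by unfold cutoff; fun_prop

theorem cutoff_nonneg (n : ℕ) (t : ℝ) : 0 ≤ cutoff n t := le_max_left _ _

theorem cutoff_le_one (n : ℕ) (t : ℝ) : cutoff n t ≤ 1 :=
  max_le zero_le_one (min_le_left _ _)

theorem cutoff_eq_one {n : ℕ} {t : ℝ} (h : |t| ≤ n) : cutoff n t = 1 := by
  rw [cutoff, min_eq_left (by linarith), max_eq_right zero_le_one]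

theorem cutoff_eq_zero {n : ℕ} {t : ℝ} (h : (n : ℝ) + 1 ≤ |t|) : cutoff n t = 0 := by
  rw [cutoff, max_eq_left ((min_le_right _ _).trans (by linarith))]

theorem monotone_cutoff (t : ℝ) : Monotone fun n => cutoff n t := fun n m h => by
  have : (n : ℝ) ≤ m := by exact_mod_cast h
  exact max_le_max le_rfl (min_le_min le_rfl (by linarith))

theorem eventually_cutoff_eq_one (t : ℝ) : ∀ᶠ n in atTop, cutoff n t = 1 := by
  filter_upwards [tendsto_natCast_atTop_atTop.eventually_ge_atTop |t|] with n hn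
  exact cutoff_eq_one hn

theorem tendsto_integral_mul_one_sub_cutoff {μ : Measure ℝ} {f : ℝ → ℝ} (hf : Integrable f μ) :
    Tendsto (fun n => ∫ x, f x * (1 - cutoff n x) ∂μ) atTop (𝓝 0) := by
  have : Tendsto (fun n => ∫ x, f x * (1 - cutoff n x) ∂μ) atTop (𝓝 (∫ _, (0 : ℝ) ∂μ)) := by
    refine tendsto_integral_of_dominated_convergence (fun x => |f x|)
      (fun n => hf.1.mul (continuous_const.sub (continuous_cutoff n)).aestronglyMeasurable)
      hf.abs (fun n => ae_of_all _ fun x => ?_) (ae_of_all _ fun x => ?_)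
    · rw [norm_mul, Real.norm_eq_abs, Real.norm_eq_abs]
      refine mul_le_of_le_one_right (abs_nonneg _) ?_
      rw [abs_le]
      constructor <;> linarith [cutoff_nonneg n x, cutoff_le_one n x]
    · refine tendsto_const_nhds.congr' ?_
      filter_upwards [eventually_cutoff_eq_one x] with n hn
      simp [hn]
  simpa using this

theorem integrable_mul_one_sub_cutoff {μ : Measure ℝ} {f : ℝ → ℝ} (hf : Integrable f μ) (n : ℕ) :
    Integrable (fun x => f x * (1 - cutoff n x)) μ := by
  refine hf.abs.mono' (hf.1.mul (continuous_const.sub (continuous_cutoff n)).aestronglyMeasurable)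
    (ae_of_all _ fun x => ?_)
  rw [norm_mul, Real.norm_eq_abs, Real.norm_eq_abs]
  refine mul_le_of_le_one_right (abs_nonneg _) ?_
  rw [abs_le]
  constructor <;> linarith [cutoff_nonneg n x, cutoff_le_one n x]

theorem hasCompactSupport_mul_prod {F : ℝ × ℝ → ℝ} {u v : ℝ → ℝ} (hu : HasCompactSupport u)
    (hv : HasCompactSupport v) : HasCompactSupport fun p : ℝ × ℝ => F p * (u p.1 * v p.2) := by
  refine HasCompactSupport.of_support_subset_isCompact (hu.isCompact.prod hv.isCompact) ?_
  intro p hp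
  have h1 : u p.1 ≠ 0 := fun h => hp (by simp [h])
  have h2 : v p.2 ≠ 0 := fun h => hp (by simp [h])
  exact ⟨subset_tsupport _ h1, subset_tsupport _ h2⟩

theorem hasCompactSupport_cutoff (n : ℕ) : HasCompactSupport (cutoff n) := by
  refine HasCompactSupport.of_support_subset_isCompact
    (isCompact_Icc (a := -(n + 1 : ℝ)) (b := n + 1)) ?_
  intro t ht
  by_contra h
  refine ht (cutoff_eq_zero ?_)
  by_contra! hc
  exact h (abs_le.1 hc.le)

theorem tendsto_integral_mul_cutoff {π : Measure (ℝ × ℝ)} {F b : ℝ × ℝ → ℝ} {u : ℝ × ℝ → ℝ}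
    (hu : Continuous u) (hF : Continuous F) (hb : Integrable b π) (hFb : ∀ p, |F p| ≤ b p) :
    Tendsto (fun n => ∫ p, F p * cutoff n (u p) ∂π) atTop (𝓝 (∫ p, F p ∂π)) := by
  refine tendsto_integral_of_dominated_convergence b
    (fun n => (hF.mul ((continuous_cutoff n).comp hu)).aestronglyMeasurable)
    hb (fun n => ae_of_all _ fun p => ?_) (ae_of_all _ fun p => ?_)
  · rw [norm_mul, Real.norm_eq_abs, Real.norm_eq_abs]
    refine (mul_le_of_le_one_right (abs_nonneg _) ?_).trans (hFb p)
    rw [abs_of_nonneg (cutoff_nonneg _ _)]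
    exact cutoff_le_one _ _
  · refine tendsto_const_nhds.congr' ?_
    filter_upwards [eventually_cutoff_eq_one (u p)] with n hn
    simp [hn]

/-- It suffices to test `E[D | X] = 0` on functions `f(X)` with `f` continuous of compact support.
-/
theorem setIntegral_eq_zero_of_forall_compactlySupported {π : Measure (ℝ × ℝ)} [IsFiniteMeasure π]
    {D : ℝ × ℝ → ℝ} (hDc : Measurable D) (hD : Integrable D π)
    (h : ∀ f : C_c(ℝ, ℝ), ∫ p, f p.1 * D p ∂π = 0) {A : Set ℝ} (hA : MeasurableSet A) :
    ∫ p in Prod.fst ⁻¹' A, D p ∂π = 0 := by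
  have hfin : ∀ E : ℝ × ℝ → ℝ, Integrable E π →
      IsFiniteMeasure (π.withDensity fun p => ENNReal.ofReal (E p)) := fun E hE =>
    isFiniteMeasure_withDensity_ofReal hE.2
  have := hfin D hD
  have := hfin (fun p => -D p) hD.neg
  have hval : ∀ E : ℝ × ℝ → ℝ, Measurable E → ∀ f : C_c(ℝ, ℝ),
      ∫ x, f x ∂((π.withDensity fun p => ENNReal.ofReal (E p)).map Prod.fst) =
        ∫ p, f p.1 * max (E p) 0 ∂π := by
    intro E hE f
    rw [integral_map measurable_fst.aemeasurable (map_continuous f).aestronglyMeasurable,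
      integral_withDensity_eq_integral_toReal_smul hE.ennreal_ofReal
        (ae_of_all _ fun _ => ENNReal.ofReal_lt_top)]
    refine integral_congr_ae (ae_of_all _ fun p => ?_)
    simp [ENNReal.toReal_ofReal', mul_comm]
  have heq : (π.withDensity fun p => ENNReal.ofReal (D p)).map Prod.fst =
      (π.withDensity fun p => ENNReal.ofReal (-D p)).map Prod.fst := by
    refine Measure.ext_of_integral_eq_on_compactlySupported fun f => ?_
    rw [hval D hDc, hval (fun p => -D p) hDc.neg, ← sub_eq_zero]
    obtain ⟨C, hC⟩ := f.hasCompactSupport.exists_bound_of_continuous f.continuous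
    have hb : ∀ E : ℝ × ℝ → ℝ, Integrable E π → Integrable (fun p => f p.1 * E p) π := fun E hE =>
      hE.bdd_mul (f.continuous.comp continuous_fst).aestronglyMeasurable
        (ae_of_all _ fun p => hC p.1)
    rw [← integral_sub (hb _ hD.pos_part) (hb _ hD.neg_part)]
    refine Eq.trans ?_ (h f)
    refine integral_congr_ae (ae_of_all _ fun p => ?_)
    simp only
    rcases le_total 0 (D p) with h0 | h0
    · rw [max_eq_left h0, max_eq_right (by linarith)]; ring
    · rw [max_eq_right h0, max_eq_left (by linarith)]; ring
  rw [integral_eq_lintegral_pos_part_sub_lintegral_neg_part hD.integrableOn]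
  have hA' := congrArg (fun ρ => ρ A) heq
  simp only [Measure.map_apply measurable_fst hA,
    withDensity_apply _ (measurable_fst hA)] at hA'
  rw [hA', sub_self]

/-- **Strassen's theorem** on the line. The inequalities for compactly supported test functions
pass to functions of one coordinate by cutting off in the other one; the cost of the cutoff is a
function of that other coordinate, so that it vanishes in the limit by integrability under the
prescribed marginal. -/
theorem ConvexOrder.exists_isMartingaleCoupling {μ ν : Measure ℝ} [IsFiniteMeasure μ]
    [IsFiniteMeasure ν] (hμ : FiniteFirstMoment μ) (hν : FiniteFirstMoment ν)
    (hle : ConvexOrder μ ν) : ∃ π, IsMartingaleCoupling π μ ν := by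
  obtain ⟨π, hπc, hπ⟩ := hle.exists_measure_integral_le hν
  have : IsFiniteMeasure π := by
    have hlim : Tendsto (fun n : ℕ => ∫⁻ p, ENNReal.ofReal (cutoff n p.1 * cutoff n p.2) ∂π) atTop
        (𝓝 (∫⁻ _, 1 ∂π)) := by
      refine lintegral_tendsto_of_tendsto_of_monotone (fun n => ?_) (ae_of_all _ fun p n m h => ?_)
        (ae_of_all _ fun p => ?_)
      · exact (((continuous_cutoff n).comp continuous_fst).mul
          ((continuous_cutoff n).comp continuous_snd)).measurable.ennreal_ofReal.aemeasurable
      · exact ENNReal.ofReal_le_ofReal (mul_le_mul (monotone_cutoff _ h) (monotone_cutoff _ h)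
          (cutoff_nonneg _ _) (cutoff_nonneg _ _))
      · refine tendsto_const_nhds.congr' ?_
        filter_upwards [eventually_cutoff_eq_one p.1, eventually_cutoff_eq_one p.2] with n h1 h2
        simp [h1, h2]
    refine ⟨lt_of_le_of_lt ?_ (ENNReal.ofReal_lt_top (r := ν.real univ))⟩
    rw [← lintegral_one]
    refine le_of_tendsto' hlim fun n => ?_
    let F : C_c(ℝ × ℝ, ℝ) := ⟨⟨fun p => 1 * (cutoff n p.1 * cutoff n p.2), by
      exact continuous_const.mul (((continuous_cutoff n).comp continuous_fst).mul
          ((continuous_cutoff n).comp continuous_snd))⟩,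
      hasCompactSupport_mul_prod (F := fun _ => 1)
        (hasCompactSupport_cutoff n) (hasCompactSupport_cutoff n)⟩
    have hF : ∀ p, F p = cutoff n p.1 * cutoff n p.2 := fun p => one_mul _
    have h1 := hπ F (fun _ => 1) 0 0 (integrable_const _) (integrable_zero _ _ _) fun x y => by
      rw [hF]
      simpa using mul_le_one₀ (cutoff_le_one n x) (cutoff_nonneg n y) (cutoff_le_one n y)
    simp only [← hF]
    rw [← ofReal_integral_eq_lintegral_ofReal F.integrable
      (ae_of_all _ fun p => by
        rw [hF]; exact mul_nonneg (cutoff_nonneg _ _) (cutoff_nonneg _ _))]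
    exact ENNReal.ofReal_le_ofReal (by simpa using h1)
  have hsnd_le : ∀ f : C_c(ℝ, ℝ), ∫ p, f p.2 ∂π ≤ ∫ y, f y ∂ν := by
    intro f
    obtain ⟨C, hC⟩ := f.hasCompactSupport.exists_bound_of_continuous f.continuous
    have hfc : Continuous fun p : ℝ × ℝ => f p.2 := f.continuous.comp continuous_snd
    have lim := tendsto_integral_mul_cutoff (π := π) continuous_fst hfc (integrable_const C)
      (fun p => hC p.2)
    have lim2 := (tendsto_integral_mul_one_sub_cutoff (integrable_const C (μ := μ))).const_add
      (∫ y, f y ∂ν)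
    rw [add_zero] at lim2
    refine le_of_tendsto_of_tendsto' lim lim2 fun n => ?_
    let F : C_c(ℝ × ℝ, ℝ) := ⟨⟨fun p => 1 * (cutoff n p.1 * f p.2), by
      exact continuous_const.mul (((continuous_cutoff n).comp continuous_fst).mul hfc)⟩,
      hasCompactSupport_mul_prod (F := fun _ => 1)
        (hasCompactSupport_cutoff n) f.hasCompactSupport⟩
    have hF : ∀ p, F p = f p.2 * cutoff n p.1 := fun p => by
      change 1 * (cutoff n p.1 * f p.2) = _; ring
    simp only [← hF]
    refine hπ F f (fun x => C * (1 - cutoff n x)) 0 f.integrable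
      (integrable_mul_one_sub_cutoff (integrable_const C) n) fun x y => ?_
    rw [hF]
    have h1 := (abs_le.1 (hC y)).1
    have h2 : 0 ≤ 1 - cutoff n x := by linarith [cutoff_le_one n x]
    have := mul_nonneg (by linarith : 0 ≤ C + f y) h2
    simp only [Pi.zero_apply, zero_mul]
    linarith
  have hfst_le : ∀ f : C_c(ℝ, ℝ), ∫ p, f p.1 ∂π ≤ ∫ x, f x ∂μ := by
    intro f
    obtain ⟨C, hC⟩ := f.hasCompactSupport.exists_bound_of_continuous f.continuous
    have hfc : Continuous fun p : ℝ × ℝ => f p.1 := f.continuous.comp continuous_fst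
    have lim := tendsto_integral_mul_cutoff (π := π) continuous_snd hfc (integrable_const C)
      (fun p => hC p.1)
    have lim2 := (tendsto_integral_mul_one_sub_cutoff (integrable_const C (μ := ν))).add_const
      (∫ x, f x ∂μ)
    rw [zero_add] at lim2
    refine le_of_tendsto_of_tendsto' lim lim2 fun n => ?_
    let F : C_c(ℝ × ℝ, ℝ) := ⟨⟨fun p => 1 * (f p.1 * cutoff n p.2), by
      exact continuous_const.mul (hfc.mul ((continuous_cutoff n).comp continuous_snd))⟩,
      hasCompactSupport_mul_prod (F := fun _ => 1)
        f.hasCompactSupport (hasCompactSupport_cutoff n)⟩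
    have hF : ∀ p, F p = f p.1 * cutoff n p.2 := fun p => by
      change 1 * (f p.1 * cutoff n p.2) = _; ring
    simp only [← hF]
    refine hπ F (fun y => C * (1 - cutoff n y)) f 0
      (integrable_mul_one_sub_cutoff (integrable_const C) n) f.integrable fun x y => ?_
    rw [hF]
    have h1 := (abs_le.1 (hC x)).1
    have h2 : 0 ≤ 1 - cutoff n y := by linarith [cutoff_le_one n y]
    have := mul_nonneg (by linarith : 0 ≤ C + f x) h2
    simp only [Pi.zero_apply, zero_mul]
    linarith
  have hsnd : π.map Prod.snd = ν := by
    refine Measure.ext_of_integral_eq_on_compactlySupported fun f => ?_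
    rw [integral_map measurable_snd.aemeasurable (map_continuous f).aestronglyMeasurable]
    have h1 := hsnd_le (-f)
    simp only [CompactlySupportedContinuousMap.coe_neg, Pi.neg_apply, integral_neg] at h1
    exact (hsnd_le f).antisymm (by linarith)
  have hfst : π.map Prod.fst = μ := by
    refine Measure.ext_of_integral_eq_on_compactlySupported fun f => ?_
    rw [integral_map measurable_fst.aemeasurable (map_continuous f).aestronglyMeasurable]
    have h1 := hfst_le (-f)
    simp only [CompactlySupportedContinuousMap.coe_neg, Pi.neg_apply, integral_neg] at h1
    exact (hfst_le f).antisymm (by linarith)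
  have hY : Integrable (fun p : ℝ × ℝ => p.2) π := by
    have : Integrable (fun x : ℝ => x) (π.map Prod.snd) := by rw [hsnd]; exact hν
    exact this.comp_measurable measurable_snd
  have hX : Integrable (fun p : ℝ × ℝ => p.1) π := by
    have : Integrable (fun x : ℝ => x) (π.map Prod.fst) := by rw [hfst]; exact hμ
    exact this.comp_measurable measurable_fst
  have hmart_le : ∀ f : C_c(ℝ, ℝ), ∫ p, f p.1 * (p.2 - p.1) ∂π ≤ 0 := by
    intro f
    obtain ⟨C, hC⟩ := f.hasCompactSupport.exists_bound_of_continuous f.continuous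
    obtain ⟨C', hC'⟩ := (f.hasCompactSupport.mul_right (f' := fun x => x)
      ).exists_bound_of_continuous
      (f.continuous.mul continuous_id)
    simp only [Real.norm_eq_abs, Pi.mul_apply] at hC hC'
    have hfc : Continuous fun p : ℝ × ℝ => f p.1 * (p.2 - p.1) :=
      (f.continuous.comp continuous_fst).mul (continuous_snd.sub continuous_fst)
    have hCint : Integrable (fun y => C * |y| + C') ν :=
      (Integrable.const_mul (Integrable.abs hν) C).add (integrable_const C')
    have hbound : ∀ x y, |f x * (y - x)| ≤ C * |y| + C' := fun x y => by
      have h1 : |f x * (y - x)| ≤ |f x * y| + |f x * x| := by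
        rw [mul_sub]; exact abs_sub _ _
      have h2 : |f x * y| ≤ C * |y| := by
        rw [abs_mul]; exact mul_le_mul_of_nonneg_right (hC x) (abs_nonneg y)
      linarith [hC' x]
    have lim := tendsto_integral_mul_cutoff (π := π) continuous_snd hfc
      (b := fun p => C * |p.2| + C') ((hY.abs.const_mul C).add (integrable_const C'))
      (fun p => hbound p.1 p.2)
    have lim2 := tendsto_integral_mul_one_sub_cutoff hCint
    refine le_of_tendsto_of_tendsto' lim lim2 fun n => ?_
    let F : C_c(ℝ × ℝ, ℝ) := ⟨⟨fun p => (p.2 - p.1) * (f p.1 * cutoff n p.2), by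
      exact (continuous_snd.sub continuous_fst).mul ((f.continuous.comp continuous_fst).mul
        ((continuous_cutoff n).comp continuous_snd))⟩,
      hasCompactSupport_mul_prod (F := fun p => p.2 - p.1)
        f.hasCompactSupport (hasCompactSupport_cutoff n)⟩
    have hF : ∀ p, F p = f p.1 * (p.2 - p.1) * cutoff n p.2 := fun p => by
      change (p.2 - p.1) * (f p.1 * cutoff n p.2) = _; ring
    simp only [← hF]
    have := hπ F (fun y => (C * |y| + C') * (1 - cutoff n y)) 0 f
      (integrable_mul_one_sub_cutoff hCint n) (integrable_zero _ _ _) fun x y => by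
        rw [hF]
        have h1 := (abs_le.1 (hbound x y)).1
        have h2 : 0 ≤ 1 - cutoff n y := by linarith [cutoff_le_one n y]
        have := mul_nonneg (by linarith : 0 ≤ C * |y| + C' + f x * (y - x)) h2
        simp only [Pi.zero_apply]
        linarith
    simpa using this
  refine ⟨π, hfst, hsnd, fun A hA => ?_⟩
  have h0 := setIntegral_eq_zero_of_forall_compactlySupported (π := π)
    (D := fun p => p.2 - p.1) (measurable_snd.sub measurable_fst) (hY.sub hX) (fun f => by
      refine (hmart_le f).antisymm ?_
      have h1 := hmart_le (-f)
      simp only [CompactlySupportedContinuousMap.coe_neg, Pi.neg_apply, neg_mul,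
        integral_neg] at h1
      linarith) hA
  rw [integral_sub hY.integrableOn hX.integrableOn] at h0
  linarith

/-! ### Martingale couplings -/

namespace IsMartingaleCoupling

variable {π : Measure (ℝ × ℝ)} {μ ν : Measure ℝ}

theorem measure_univ_eq (h : IsMartingaleCoupling π μ ν) : π univ = ν univ := by
  rw [← h.map_snd, Measure.map_apply measurable_snd .univ, preimage_univ]

theorem isFiniteMeasure [IsFiniteMeasure ν] (h : IsMartingaleCoupling π μ ν) :
    IsFiniteMeasure π := ⟨by rw [h.measure_univ_eq]; exact measure_lt_top ν univ⟩

theorem integrable_snd (h : IsMartingaleCoupling π μ ν) (hν : FiniteFirstMoment ν) :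
    Integrable (fun p : ℝ × ℝ => p.2) π := by
  have : Integrable (fun x : ℝ => x) (π.map Prod.snd) := by rw [h.map_snd]; exact hν
  exact this.comp_measurable measurable_snd

theorem integrable_fst (h : IsMartingaleCoupling π μ ν) (hμ : FiniteFirstMoment μ) :
    Integrable (fun p : ℝ × ℝ => p.1) π := by
  have : Integrable (fun x : ℝ => x) (π.map Prod.fst) := by rw [h.map_fst]; exact hμ
  exact this.comp_measurable measurable_fst

theorem add {π' : Measure (ℝ × ℝ)} {μ' ν' : Measure ℝ} (h : IsMartingaleCoupling π μ ν)
    (h' : IsMartingaleCoupling π' μ' ν') (hμ : FiniteFirstMoment μ) (hν : FiniteFirstMoment ν)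
    (hμ' : FiniteFirstMoment μ') (hν' : FiniteFirstMoment ν') :
    IsMartingaleCoupling (π + π') (μ + μ') (ν + ν') where
  map_fst := by rw [Measure.map_add _ _ measurable_fst, h.map_fst, h'.map_fst]
  map_snd := by rw [Measure.map_add _ _ measurable_snd, h.map_snd, h'.map_snd]
  setIntegral_eq A hA := by
    rw [Measure.restrict_add,
      integral_add_measure (h.integrable_snd hν).integrableOn (h'.integrable_snd hν').integrableOn,
      integral_add_measure (h.integrable_fst hμ).integrableOn (h'.integrable_fst hμ').integrableOn,
      h.setIntegral_eq A hA, h'.setIntegral_eq A hA]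

end IsMartingaleCoupling

theorem mem_martingaleTransports_iff {π : Measure (ℝ × ℝ)} {μ ν : Measure ℝ} [IsFiniteMeasure ν]
    (hμ : FiniteFirstMoment μ) (hν : FiniteFirstMoment ν) :
    π ∈ martingaleTransports μ ν ↔ IsMartingaleCoupling π μ ν := by
  have hm : MeasurableSpace.comap (Prod.fst : ℝ × ℝ → ℝ) inferInstance ≤
      (inferInstance : MeasurableSpace (ℝ × ℝ)) := measurable_fst.comap_le
  have key : π.map Prod.fst = μ → π.map Prod.snd = ν → IsFiniteMeasure π ∧
      Integrable (fun p : ℝ × ℝ => p.2) π ∧ Integrable (fun p : ℝ × ℝ => p.1) π := by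
    intro h1 h2
    refine ⟨⟨?_⟩, ?_, ?_⟩
    · rw [← preimage_univ (f := (Prod.snd : ℝ × ℝ → ℝ)), ← Measure.map_apply measurable_snd .univ,
        h2]
      exact measure_lt_top ν univ
    · have : Integrable (fun x : ℝ => x) (π.map Prod.snd) := by rw [h2]; exact hν
      exact this.comp_measurable measurable_snd
    · have : Integrable (fun x : ℝ => x) (π.map Prod.fst) := by rw [h1]; exact hμ
      exact this.comp_measurable measurable_fst
  constructor
  · rintro ⟨h1, h2, h3⟩
    obtain ⟨_, hY, hX⟩ := key h1 h2
    refine ⟨h1, h2, fun A hA => ?_⟩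
    rw [← setIntegral_condExp hm hY ⟨A, hA, rfl⟩]
    exact integral_congr_ae (ae_restrict_of_ae h3)
  · rintro ⟨h1, h2, h3⟩
    obtain ⟨_, hY, hX⟩ := key h1 h2
    refine ⟨h1, h2, (ae_eq_condExp_of_forall_setIntegral_eq hm hY (fun s _ _ => hX.integrableOn)
      ?_ ?_).symm⟩
    · rintro _ ⟨A, hA, rfl⟩ _
      exact (h3 A hA).symm
    · exact (comap_measurable (Prod.fst : ℝ × ℝ → ℝ)).stronglyMeasurable.aestronglyMeasurable

/-! ### Images of parts of the first marginal -/

/-- The part of the second marginal of `π` that comes from `A`, that is, the law of `Y` on the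
event `X ∈ A`. -/
noncomputable def imageOn (π : Measure (ℝ × ℝ)) (A : Set ℝ) : Measure ℝ :=
  (π.restrict (Prod.fst ⁻¹' A)).map Prod.snd

theorem imageOn_apply (π : Measure (ℝ × ℝ)) (A : Set ℝ) {B : Set ℝ} (hB : MeasurableSet B) :
    imageOn π A B = π (A ×ˢ B) := by
  rw [imageOn, Measure.map_apply measurable_snd hB, Measure.restrict_apply (measurable_snd hB)]
  congr 1
  ext p; simp [and_comm]

theorem imageOn_add_compl (π : Measure (ℝ × ℝ)) {A : Set ℝ} (hA : MeasurableSet A) :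
    imageOn π A + imageOn π Aᶜ = π.map Prod.snd := by
  rw [imageOn, imageOn, ← Measure.map_add _ _ measurable_snd, preimage_compl,
    Measure.restrict_add_restrict_compl (measurable_fst hA)]

theorem imageOn_le (π : Measure (ℝ × ℝ)) (A : Set ℝ) : imageOn π A ≤ π.map Prod.snd :=
  Measure.map_mono Measure.restrict_le_self measurable_snd

/-- For calls, Jensen's inequality follows from `(y - k)⁺ ≥ (x - k)⁺ + 1_{x > k} (y - x)`. -/
theorem IsMartingaleCoupling.convexOrder_imageOn {π : Measure (ℝ × ℝ)} {μ ν : Measure ℝ}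
    [IsFiniteMeasure μ] [IsFiniteMeasure ν] (hμ : FiniteFirstMoment μ) (hν : FiniteFirstMoment ν)
    (h : IsMartingaleCoupling π μ ν) {A : Set ℝ} (hA : MeasurableSet A) :
    ConvexOrder (μ.restrict A) (imageOn π A) := by
  have := h.isFiniteMeasure
  have hX := h.integrable_fst hμ
  have hY := h.integrable_snd hν
  have hle : imageOn π A ≤ ν := h.map_snd ▸ imageOn_le π A
  have : IsFiniteMeasure (imageOn π A) := isFiniteMeasure_of_le ν hle
  have hμA : μ.restrict A = (π.restrict (Prod.fst ⁻¹' A)).map Prod.fst := by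
    rw [← h.map_fst, Measure.restrict_map measurable_fst hA]
  have hintμ : ∀ f : ℝ → ℝ, Measurable f →
      ∫ x in A, f x ∂μ = ∫ p in Prod.fst ⁻¹' A, f p.1 ∂π := fun f hf => by
    rw [hμA, integral_map measurable_fst.aemeasurable hf.aestronglyMeasurable]
  have hintν : ∀ f : ℝ → ℝ, Measurable f →
      ∫ y, f y ∂(imageOn π A) = ∫ p in Prod.fst ⁻¹' A, f p.2 ∂π := fun f hf => by
    rw [imageOn, integral_map measurable_snd.aemeasurable hf.aestronglyMeasurable]
  refine convexOrder_of_call (hμ.mono Measure.restrict_le_self) (hν.mono hle) ?_ ?_ fun k => ?_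
  · rw [hμA, imageOn, measureReal_def, measureReal_def, Measure.map_apply measurable_fst .univ,
      Measure.map_apply measurable_snd .univ, preimage_univ, preimage_univ]
  · rw [hintμ _ measurable_id', hintν _ measurable_id', h.setIntegral_eq A hA]
  · have hk : Measurable fun x : ℝ => max (x - k) 0 := by fun_prop
    rw [call, call, hintμ _ hk, hintν _ hk]
    have hXk : IntegrableOn (fun p : ℝ × ℝ => max (p.1 - k) 0) (Prod.fst ⁻¹' A) π :=
      (hX.sub (integrable_const k)).pos_part.integrableOn
    have hYk : IntegrableOn (fun p : ℝ × ℝ => max (p.2 - k) 0) (Prod.fst ⁻¹' A) π :=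
      (hY.sub (integrable_const k)).pos_part.integrableOn
    have hD : IntegrableOn ((Prod.fst ⁻¹' Ioi k).indicator fun p : ℝ × ℝ => p.2 - p.1)
        (Prod.fst ⁻¹' A) π :=
      ((hY.sub hX).indicator (measurable_fst measurableSet_Ioi)).integrableOn
    have hD0 : ∫ p in Prod.fst ⁻¹' A,
        (Prod.fst ⁻¹' Ioi k).indicator (fun p : ℝ × ℝ => p.2 - p.1) p ∂π = 0 := by
      rw [setIntegral_indicator (measurable_fst measurableSet_Ioi), ← preimage_inter,
        integral_sub hY.integrableOn hX.integrableOn,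
        h.setIntegral_eq _ (hA.inter measurableSet_Ioi), sub_self]
    have := integral_mono (hXk.add hD) hYk fun p => by
      simp only [Pi.add_apply, indicator, mem_preimage, mem_Ioi]
      split_ifs with hp
      · rw [max_eq_left (by linarith)]
        linarith [le_max_left (p.2 - k) 0]
      · rw [max_eq_right (by linarith), add_zero]
        exact le_max_right _ _
    simp only [Pi.add_apply] at this
    rw [integral_add hXk hD, hD0, add_zero] at this
    exact this

/-! ### Singular shadows and Monge couplings -/

theorem add_le_of_mutuallySingular {η ρ ν : Measure ℝ} (h : η.MutuallySingular ρ)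
    (hη : η ≤ ν) (hρ : ρ ≤ ν) : η + ρ ≤ ν := by
  obtain ⟨S, hS, h1, h2⟩ := h
  refine Measure.le_iff.2 fun E hE => ?_
  have e1 : η E ≤ η (E \ S) := by
    rw [← measure_inter_add_sdiff E hS,
      measure_mono_null (show E ∩ S ⊆ S from inter_subset_right) h1, zero_add]
  have e2 : ρ E ≤ ρ (E ∩ S) := by
    rw [← measure_inter_add_sdiff E hS,
      measure_mono_null (show E \ S ⊆ Sᶜ from fun x hx => hx.2) h2, add_zero]
  calc η E + ρ E ≤ ν (E \ S) + ν (E ∩ S) := add_le_add (e1.trans (hη _)) (e2.trans (hρ _))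
    _ = ν E := by rw [add_comm, measure_inter_add_sdiff E hS]

/-- If the shadows of the two halves of `μ` are mutually singular, they add up to `ν`. Each of
them is below the corresponding image under `π` in the convex order, and these images add up to
`ν` as well, so that they have to coincide. -/
theorem IsMartingaleCoupling.imageOn_eq_shadow {π : Measure (ℝ × ℝ)} {μ ν : Measure ℝ}
    [IsFiniteMeasure μ] [IsFiniteMeasure ν] (hμ : FiniteFirstMoment μ) (hν : FiniteFirstMoment ν)
    (hμν : ConvexOrder μ ν) (h : IsMartingaleCoupling π μ ν) {A : Set ℝ} (hA : MeasurableSet A)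
    (hsing : (shadow ν (μ.restrict A)).MutuallySingular (shadow ν (μ.restrict Aᶜ))) :
    imageOn π A = shadow ν (μ.restrict A) := by
  have hmA : FiniteFirstMoment (μ.restrict A) := hμ.mono Measure.restrict_le_self
  have hmAc : FiniteFirstMoment (μ.restrict Aᶜ) := hμ.mono Measure.restrict_le_self
  have hS : ∀ B, MeasurableSet B → IsShadow ν (μ.restrict B) (shadow ν (μ.restrict B)) :=
    fun B hB => (isShadow_shadow_and_convexOrder_sub (μ₂ := μ.restrict Bᶜ)
      (hμ.mono Measure.restrict_le_self) (hμ.mono Measure.restrict_le_self) hν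
      (by rwa [Measure.restrict_add_restrict_compl hB])).1
  set η := shadow ν (μ.restrict A) with hη
  set ρ := shadow ν (μ.restrict Aᶜ) with hρ
  have sη : IsShadow ν (μ.restrict A) η := hS A hA
  have sρ : IsShadow ν (μ.restrict Aᶜ) ρ := hS Aᶜ hA.compl
  have : IsFiniteMeasure η := isFiniteMeasure_of_le ν sη.le
  have : IsFiniteMeasure ρ := isFiniteMeasure_of_le ν sρ.le
  have hπA : imageOn π A ≤ ν := h.map_snd ▸ imageOn_le π A
  have hπAc : imageOn π Aᶜ ≤ ν := h.map_snd ▸ imageOn_le π Aᶜ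
  have : IsFiniteMeasure (imageOn π A) := isFiniteMeasure_of_le ν hπA
  have : IsFiniteMeasure (imageOn π Aᶜ) := isFiniteMeasure_of_le ν hπAc
  have hle := add_le_of_mutuallySingular hsing sη.le sρ.le
  have hsum : η + ρ = ν := by
    have hadd : ν - (η + ρ) + (η + ρ) = ν := Measure.sub_add_cancel_of_le hle
    have h0 : ν - (η + ρ) = 0 := by
      have m1 := sη.convexOrder.real_univ_eq
      have m2 := sρ.convexOrder.real_univ_eq
      have m3 := hμν.real_univ_eq
      have m4 := congrArg (fun σ : Measure ℝ => σ.real univ) hadd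
      have m5 := congrArg (fun σ : Measure ℝ => σ.real univ)
        (Measure.restrict_add_restrict_compl (μ := μ) hA)
      have : IsFiniteMeasure (ν - (η + ρ)) := isFiniteMeasure_of_le ν Measure.sub_le
      change (ν - (η + ρ) + (η + ρ)).real univ = ν.real univ at m4
      change (μ.restrict A + μ.restrict Aᶜ).real univ = μ.real univ at m5
      rw [measureReal_add_apply, measureReal_add_apply] at m4
      rw [measureReal_add_apply] at m5
      have m6 : (ν - (η + ρ)).real univ = 0 := by linarith
      rwa [measureReal_eq_zero_iff, Measure.measure_univ_eq_zero] at m6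
    rw [h0, zero_add] at hadd
    exact hadd
  have c1 := fun x => (sη.min _ (h.convexOrder_imageOn hμ hν hA) hπA).call_le (hν.mono hπA) x
  have c2 := fun x =>
    (sρ.min _ (h.convexOrder_imageOn hμ hν hA.compl) hπAc).call_le (hν.mono hπAc) x
  refine ext_of_call (hν.mono hπA) (hν.mono sη.le) fun x => ?_
  have e1 := call_add_measure (hν.mono hπA) (hν.mono hπAc) x
  rw [imageOn_add_compl π hA, h.map_snd, ← hsum,
    call_add_measure (hν.mono sη.le) (hν.mono sρ.le)] at e1
  linarith [c1 x, c2 x]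

open Classical in
/-- If `X ≤ q` and `X > q` can be told apart by looking at `Y`, for every rational `q`, then `X`
is a function of `Y`: the infimum of the `q` for which `Y` signals `X ≤ q`. -/
theorem exists_measurable_eq_map_of_mutuallySingular_imageOn {π : Measure (ℝ × ℝ)}
    (h : ∀ q : ℚ, (imageOn π (Iic (q : ℝ))).MutuallySingular (imageOn π (Iic (q : ℝ))ᶜ)) :
    ∃ f : ℝ → ℝ, Measurable f ∧ π = (π.map Prod.snd).map fun y => (f y, y) := by
  choose S hS h1 h2 using h
  let F : ℝ → EReal := fun y =>
    ⨅ q : ℚ, (S q).piecewise (fun _ => (⊤ : EReal)) (fun _ => ((q : ℝ) : EReal)) y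
  have hF : Measurable F := Measurable.iInf fun q =>
    Measurable.piecewise (hS q) measurable_const measurable_const
  refine ⟨fun y => (F y).toReal, hF.ereal_toReal, ?_⟩
  have hae : ∀ᵐ p ∂π, p = ((F p.2).toReal, p.2) := by
    have hq : ∀ q : ℚ, ∀ᵐ p ∂π, p.1 ≤ (q : ℝ) ↔ p.2 ∉ S q := by
      intro q
      have n1 := h1 q
      have n2 := h2 q
      rw [imageOn_apply _ _ (hS q)] at n1
      rw [imageOn_apply _ _ (hS q).compl] at n2
      filter_upwards [measure_eq_zero_iff_ae_notMem.1 n1, measure_eq_zero_iff_ae_notMem.1 n2]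
        with p hp1 hp2
      simp only [mem_prod, mem_Iic, mem_compl_iff, not_and, not_not, not_le] at hp1 hp2
      exact ⟨hp1, fun hp => by by_contra! hc; exact hp (hp2 hc)⟩
    filter_upwards [ae_all_iff.2 hq] with p hp
    have : F p.2 = (p.1 : EReal) := by
      refine le_antisymm ?_ ?_
      · refine EReal.le_of_forall_lt_iff_le.1 fun z hz => ?_
        obtain ⟨q, hq1, hq2⟩ := exists_rat_btwn (EReal.coe_lt_coe_iff.1 hz)
        refine (iInf_le _ q).trans ?_
        rw [piecewise_eq_of_notMem _ _ _ ((hp q).1 hq1.le)]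
        exact EReal.coe_le_coe_iff.2 hq2.le
      · refine le_iInf fun q => ?_
        by_cases hqS : p.2 ∈ S q
        · rw [piecewise_eq_of_mem _ _ _ hqS]; exact le_top
        · rw [piecewise_eq_of_notMem _ _ _ hqS]
          exact EReal.coe_le_coe_iff.2 ((hp q).2 hqS)
    rw [this, EReal.toReal_coe]
  rw [Measure.map_map (hF.ereal_toReal.prodMk measurable_id') measurable_snd]
  conv_lhs => rw [← Measure.map_id (μ := π)]
  exact Measure.map_congr hae

/-- If the unique martingale coupling is the law of `(f(Y), Y)`, the shadow of `μ₁` does not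
charge `f ⁻¹' s` for `μ₁`-null sets `s`: couplings of `μ₁` with its shadow and of the rest with
the rest add up to the unique coupling, on which `X = f(Y)`. -/
theorem shadow_preimage_eq_zero {μ ν : Measure ℝ} [IsFiniteMeasure μ] [IsFiniteMeasure ν]
    (hμ : FiniteFirstMoment μ) (hν : FiniteFirstMoment ν) (hμν : ConvexOrder μ ν)
    {π : Measure (ℝ × ℝ)} (huniq : ∀ π', IsMartingaleCoupling π' μ ν → π' = π)
    {f : ℝ → ℝ} (hf : Measurable f) (hπ : π = ν.map fun y => (f y, y)) {μ₁ : Measure ℝ}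
    (hle : μ₁ ≤ μ) {s : Set ℝ} (hs : MeasurableSet s) (h0 : μ₁ s = 0) :
    shadow ν μ₁ (f ⁻¹' s) = 0 := by
  have : IsFiniteMeasure μ₁ := isFiniteMeasure_of_le μ hle
  have : IsFiniteMeasure (μ - μ₁) := isFiniteMeasure_of_le μ Measure.sub_le
  have hadd : μ₁ + (μ - μ₁) = μ := by rw [add_comm]; exact Measure.sub_add_cancel_of_le hle
  have hm1 := hμ.mono hle
  have hm2 : FiniteFirstMoment (μ - μ₁) := hμ.mono Measure.sub_le
  obtain ⟨hS, ρ, hsum, hρ⟩ := isShadow_shadow_and_convexOrder_sub hm1 hm2 hν (by rwa [hadd])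
  have hρν : ρ ≤ ν := hsum ▸ Measure.le_add_left le_rfl
  have : IsFiniteMeasure (shadow ν μ₁) := isFiniteMeasure_of_le ν hS.le
  have : IsFiniteMeasure ρ := isFiniteMeasure_of_le ν hρν
  obtain ⟨π₁, hπ₁⟩ := hS.convexOrder.exists_isMartingaleCoupling hm1 (hν.mono hS.le)
  obtain ⟨π₂, hπ₂⟩ := hρ.exists_isMartingaleCoupling hm2 (hν.mono hρν)
  have hcoup := hπ₁.add hπ₂ hm1 (hν.mono hS.le) hm2 (hν.mono hρν)
  rw [hadd, hsum] at hcoup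
  have hle1 : π₁ ≤ π := huniq _ hcoup ▸ Measure.le_add_right le_rfl
  rw [← hπ₁.map_snd, Measure.map_apply measurable_snd (hf hs)]
  have hsub : Prod.snd ⁻¹' (f ⁻¹' s) ⊆ (Prod.fst ⁻¹' s ∪ sᶜ ×ˢ (f ⁻¹' s) : Set (ℝ × ℝ)) := by
    intro p hp
    by_cases h : p.1 ∈ s
    · exact Or.inl h
    · exact Or.inr ⟨h, hp⟩
  refine measure_mono_null hsub (measure_union_null ?_ ?_)
  · rw [← Measure.map_apply measurable_fst hs, hπ₁.map_fst, h0]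
  · refine le_antisymm ((hle1 _).trans ?_) zero_le
    rw [hπ, Measure.map_apply (hf.prodMk measurable_id') (hs.compl.prod (hf hs))]
    have : (fun y => (f y, y)) ⁻¹' (sᶜ ×ˢ (f ⁻¹' s)) = ∅ := by
      ext y; simp
    rw [this, measure_empty]

theorem proposition4p12 (μ ν : Measure ℝ) [IsProbabilityMeasure μ] [IsProbabilityMeasure ν]
    (hμ : FiniteFirstMoment μ) (hν : FiniteFirstMoment ν) (hμν : ConvexOrder μ ν) :
    (∃ π : Measure (ℝ × ℝ),
        martingaleTransports μ ν = {π} ∧ π ∈ mongeMartingaleTransports μ ν) ↔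
      ∀ (n : ℕ) (μs : Fin n → Measure ℝ), (∀ i, μs i ≤ μ) →
        (Pairwise fun i j => (μs i).MutuallySingular (μs j)) →
        Pairwise fun i j => (shadow ν (μs i)).MutuallySingular (shadow ν (μs j)) := by
  constructor
  · rintro ⟨π, huniq, -, f, hf, hπ⟩ n μs hle hsing i j hij
    have huniq' : ∀ π', IsMartingaleCoupling π' μ ν → π' = π := fun π' h => by
      rw [← mem_martingaleTransports_iff hμ hν, huniq] at h
      exact h
    obtain ⟨s, hs, h1, h2⟩ := hsing hij
    exact ⟨f ⁻¹' s, hf hs, shadow_preimage_eq_zero hμ hν hμν huniq' hf hπ (hle i) hs h1,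
      shadow_preimage_eq_zero hμ hν hμν huniq' hf hπ (hle j) hs.compl h2⟩
  · intro hsh
    have hsing : ∀ A, MeasurableSet A →
        (shadow ν (μ.restrict A)).MutuallySingular (shadow ν (μ.restrict Aᶜ)) := by
      intro A hA
      have hAAc : (μ.restrict A).MutuallySingular (μ.restrict Aᶜ) :=
        ⟨Aᶜ, hA.compl, by simp [hA.compl], by simp [hA]⟩
      refine hsh 2 ![μ.restrict A, μ.restrict Aᶜ] (fun i => ?_) (fun i j hij => ?_)
        (show (0 : Fin 2) ≠ 1 by decide)
      · fin_cases i <;> exact Measure.restrict_le_self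
      · fin_cases i <;> fin_cases j
        · exact absurd rfl hij
        · exact hAAc
        · exact hAAc.symm
        · exact absurd rfl hij
    have himage : ∀ π, IsMartingaleCoupling π μ ν → ∀ A, MeasurableSet A →
        imageOn π A = shadow ν (μ.restrict A) := fun π h A hA =>
      h.imageOn_eq_shadow hμ hν hμν hA (hsing A hA)
    obtain ⟨π, hπ⟩ := hμν.exists_isMartingaleCoupling hμ hν
    have hmem := (mem_martingaleTransports_iff hμ hν).2 hπ
    refine ⟨π, ?_, hmem, ?_⟩
    · refine eq_singleton_iff_unique_mem.2 ⟨hmem, fun π' hπ' => ?_⟩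
      rw [mem_martingaleTransports_iff hμ hν] at hπ'
      have := hπ.isFiniteMeasure
      have := hπ'.isFiniteMeasure
      refine Measure.ext_prod fun {A B} hA hB => ?_
      rw [← imageOn_apply _ _ hB, ← imageOn_apply _ _ hB, himage π hπ A hA, himage π' hπ' A hA]
    · obtain ⟨f, hf, h⟩ := exists_measurable_eq_map_of_mutuallySingular_imageOn (π := π) fun q => by
        rw [himage π hπ _ measurableSet_Iic, himage π hπ _ measurableSet_Iic.compl]
        exact hsing _ measurableSet_Iic
      rw [hπ.map_snd] at h
      exact ⟨f, hf, h⟩
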